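/- Let $\mathcal X(t)$, $t\ge 0$, be a continuous-time Markov chain with finite state space $\{1,\dots,\mathcal S\}$ and infinitesimal generator $\mathbf Q$. For each block length $N\ge 1$, consider a channel whose state sequence is the sampled chain $S_n=\mathcal X(n/N)$, $n=0,\dots,N$, so that the states change rarely when $N$ is large. The $n$-th use of the channel is a binary symmetric channel with crossover probability $\varepsilon_{S_{n-1}}$, where $0\le\varepsilon_1<\dots<\varepsilon_{\mathcal S}\le\frac12$; given the states, the uses are independent of each other, and the states do not depend on the inputs. A random code of rate $R$ (in nats) with $M=e^{NR}$ codewords of length $N$ (rounded down or up to an integer) is used, all symbols of all codewords being independent and uniform on the two inputs. The receiver knows the channel states and uses maximum-likelihood decoding, with ties resolved in any way or counted as failures. Let $P_{\mathrm e,S_N|S_0}(j|i)$ be the probability, averaged over the random code, that a given transmitted message is decoded erroneously and $S_N=j$, conditioned on $S_0=i$ (where $\Pr(S_0=i)>0$). Fix $\rho\in[0,1]$ and set $$b_s(\rho)=-\ln\Big[\frac1{2^\rho}\Big(\varepsilon_s^{\frac1{1+\rho}}+(1-\varepsilon_s)^{\frac1{1+\rho}}\Big)^{1+\rho}\Big],\qquad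 W(\rho)=\sum_{s=1}^{\mathcal S} b_s(\rho)\int_0^1\mathbf 1_{\{\mathcal X(t)=s\}}\,dt ,$$ and let $W_N(\rho)$ be defined like $W(\rho)$ with $\mathcal X(t)$ replaced by $\mathcal X_N(t)=\mathcal X(\lfloor Nt\rfloor/N)$. Let $G_{j|i}$ and $G_{N,j|i}$ be the measures on $\mathbb R$ given by $$G_{j|i}(B)=\Pr(W(\rho)\in B,\ \mathcal X(1)=j\mid \mathcal X(0)=i),\qquad G_{N,j|i}(B)=\Pr(W_N(\rho)\in B,\ \mathcal X(1)=j\mid \mathcal X(0)=i),$$ and let $g_N(w)=\min\{1,e^{-N(w-\rho R)}\}$. All integrals below are over $w\in[b_{\mathcal S}(\rho),b_1(\rho)]$. Then: 1. for every $N\ge1$, $\displaystyle P_{\mathrm e,S_N|S_0}(j|i)\le\int g_N\,dG_{N,j|i}$; 2. $\displaystyle\lim_{N\to\infty}\int g_N\,dG_{N,j|i}=\int \mathbf 1_{(-\infty,\rho R]}\,dG_{j|i}$; 3. $\displaystyle\lim_{N\to\infty}\int g_N\,dG_{j|i}=\int \mathbf 1_{(-\infty,\rho R]}\,dG_{j|i}$.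 Consequently, $P_{\mathrm e,S_N|S_0}(j|i)\lesssim\int g_N\,dG_{j|i}$ in the following sense: for every $\delta>0$ there is an $N_0$ such that for all $N\ge N_0$, every such decoder and every transmitted message, $P_{\mathrm e,S_N|S_0}(j|i)\le\int g_N\,dG_{j|i}+\delta$. -/

import Mathlib

open MeasureTheory ProbabilityTheory Filter Topology
open scoped ENNReal NNReal BigOperators

noncomputable section

namespace RareTransition

/-! ### Continuous-time Markov chains on a finite state space -/

/-- `Q` is an infinitesimal generator: non-negative off-diagonal rates, rows summing to zero. -/
structure IsGenerator {ι : Type*} [Fintype ι] (Q : Matrix ι ι ℝ) : Prop where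
  rate_nonneg : ∀ i j, i ≠ j → 0 ≤ Q i j
  row_sum : ∀ i, ∑ j, Q i j = 0

/-- The rate `q i = -Q i i` at which state `i` is left. -/
def exitRate {ι : Type*} (Q : Matrix ι ι ℝ) (i : ι) : ℝ := -Q i i

/-- The transition matrix of the jump chain: `Q i j / q i` off the diagonal when `q i ≠ 0`;
a state with `q i = 0` is absorbing. -/
def jumpMatrix {ι : Type*} [DecidableEq ι] (Q : Matrix ι ι ℝ) (i j : ι) : ℝ :=
  if exitRate Q i = 0 then (if i = j then 1 else 0)
  else (if i = j then 0 else Q i j / exitRate Q i)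

/-- `Y` and `T` are the jump chain and the holding times of a chain with generator `Q`:
`Y` is a Markov chain with transition matrix `jumpMatrix Q` and, given the visited states, the
holding times are independent, the `k`-th one being exponential with parameter
`exitRate Q (Y k)` (equal to `∞` when this rate is zero). -/
structure IsJumpHolding {Ω ι : Type*} [MeasurableSpace Ω] [DecidableEq ι] [MeasurableSpace ι]
    (μ : Measure Ω) (Q : Matrix ι ι ℝ) (Y : ℕ → Ω → ι) (T : ℕ → Ω → ℝ≥0∞) : Prop where
  measurable_state : ∀ k, Measurable (Y k)
  measurable_hold : ∀ k, Measurable (T k)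
  law : ∀ (n : ℕ) (y : ℕ → ι) (r : ℕ → ℝ≥0),
    μ {ω | (∀ k ≤ n, Y k ω = y k) ∧ ∀ k < n, (r k : ℝ≥0∞) < T k ω} =
      μ {ω | Y 0 ω = y 0} *
        ∏ k ∈ Finset.range n,
          ENNReal.ofReal (jumpMatrix Q (y k) (y (k + 1)) * Real.exp (-(exitRate Q (y k) * r k)))

/-- `X` (at times `t ≥ 0`) is a continuous-time Markov chain with generator `Q` under `μ`, with
arbitrary initial law: almost surely, it sits in the `n`-th state of its jump chain from the
`n`-th jump time (the sum of the first `n` holding times) until just before the next one. -/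
structure IsCTMC {Ω ι : Type*} [MeasurableSpace Ω] [DecidableEq ι] [MeasurableSpace ι]
    (μ : Measure Ω) (Q : Matrix ι ι ℝ) (X : ℝ → Ω → ι) : Prop where
  measurable : ∀ t, 0 ≤ t → Measurable (X t)
  jump_holding : ∃ (Y : ℕ → Ω → ι) (T : ℕ → Ω → ℝ≥0∞), IsJumpHolding μ Q Y T ∧
    ∀ᵐ ω ∂μ, ∀ t : ℝ, 0 ≤ t → ∀ n : ℕ,
      ∑ k ∈ Finset.range n, T k ω ≤ ENNReal.ofReal t →
      ENNReal.ofReal t < ∑ k ∈ Finset.range (n + 1), T k ω → X t ω = Y n ω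

/-- The process sampled every `1 / N` units of time, `X_N(t) = X(⌊N t⌋ / N)`. -/
def sampled {Ω ι : Type*} (N : ℕ) (X : ℝ → Ω → ι) (t : ℝ) : Ω → ι :=
  X ((⌊(N : ℝ) * t⌋ : ℝ) / N)

/-- The time spent in state `i` during `[0, 1]`, along the outcome `ω`. -/
def occupationTime {Ω ι : Type*} [DecidableEq ι] (X : ℝ → Ω → ι) (i : ι) (ω : Ω) : ℝ :=
  ∫ t in (0 : ℝ)..1, if X t ω = i then 1 else 0

/-- The weighted occupation time `∑ i, η_i b_i`. -/
def weightedOccupation {Ω ι : Type*} [Fintype ι] [DecidableEq ι] (b : ι → ℝ) (X : ℝ → Ω → ι)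
    (ω : Ω) : ℝ :=
  ∑ i, occupationTime X i ω * b i

/-- The measure `B ↦ Pr(W ∈ B, X(1) = j | X(0) = i)`, with `W` the weighted occupation time
of `X`: the joint law of `W` and the final state, given the initial state. -/
def occupationLaw {Ω ι : Type*} [MeasurableSpace Ω] [Fintype ι] [DecidableEq ι]
    (μ : Measure Ω) (b : ι → ℝ) (X : ℝ → Ω → ι) (i j : ι) : Measure ℝ :=
  ((μ[|{ω | X 0 ω = i}]).restrict {ω | X 1 ω = j}).map (weightedOccupation b X)

/-! ### Random coding over a Gilbert-Elliott type channel -/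

/-- The exponent `b(ρ)` of a binary symmetric channel with crossover probability `e`. -/
def bscExponent (e ρ : ℝ) : ℝ :=
  -Real.log (1 / (2 : ℝ) ^ ρ * (e ^ (1 / (1 + ρ)) + (1 - e) ^ (1 / (1 + ρ))) ^ (1 + ρ))

/-- The probability that a binary symmetric channel with crossover probability `e` outputs `y`
on input `x`. -/
def bscProb (e : ℝ) (x y : Bool) : ℝ := if x = y then 1 - e else e

/-- The probability of receiving `y` when `x` is sent and the states are `s 0, …, s N`; the
`n`-th use of the channel (`n = 1, …, N`) is governed by the state `s (n - 1)`. -/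
def likelihood {ι : Type*} {N : ℕ} (ε : ι → ℝ) (s : Fin (N + 1) → ι) (x y : Fin N → Bool) : ℝ :=
  ∏ n : Fin N, bscProb (ε (s n.castSucc)) (x n) (y n)

/-- A code with `M` codewords of length `N`. -/
abbrev Codebook (M N : ℕ) : Type := Fin M → Fin N → Bool

/-- The probability of a codebook in the ensemble in which all symbols of all codewords are
drawn independently from the uniform distribution on the two input symbols. -/
def codebookProb {M N : ℕ} (c : Codebook M N) : ℝ :=
  ∏ k : Fin M, ∏ n : Fin N, (fun _ : Bool => (1 / 2 : ℝ)) (c k n)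

/-- A decoder that knows the states, the codebook and the channel output; `none` means that it
declares a failure. -/
abbrev Decoder (ι : Type*) (M N : ℕ) : Type _ :=
  (Fin (N + 1) → ι) → Codebook M N → (Fin N → Bool) → Option (Fin M)

/-- Message `l` maximizes the likelihood of the output `y`. -/
def IsMostLikely {ι : Type*} {M N : ℕ} (ε : ι → ℝ) (s : Fin (N + 1) → ι) (c : Codebook M N)
    (y : Fin N → Bool) (l : Fin M) : Prop :=
  ∀ k, likelihood ε s (c k) y ≤ likelihood ε s (c l) y

/-- Maximum-likelihood decoding. Ties may be resolved in any way, and they may also be declared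
as failures. -/
def IsMaximumLikelihood {ι : Type*} {M N : ℕ} (ε : ι → ℝ) (dec : Decoder ι M N) : Prop :=
  ∀ s c y, (∀ l, dec s c y = some l → IsMostLikely ε s c y l) ∧
    (dec s c y = none → ∃ k l, k ≠ l ∧ IsMostLikely ε s c y k ∧ IsMostLikely ε s c y l)

/-- The probability, over the random codebook and the channel noise, that message `k` is
decoded erroneously, given that it was sent and that the state sequence is `s`. -/
def errorGivenStates {ι : Type*} {M N : ℕ} (ε : ι → ℝ) (dec : Decoder ι M N) (k : Fin M)
    (s : Fin (N + 1) → ι) : ℝ :=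
  ∑ c : Codebook M N, codebookProb c *
    ∑ y : Fin N → Bool, likelihood ε s (c k) y * (if dec s c y = some k then 0 else 1)

/-- `P_{e, S_N | S_0}(j | i)`: the probability that message `k`, when sent, is decoded
erroneously and the final state is `S_N = j`, given `S_0 = i`; the channel states are the
samples `S_n = X(n / N)`. -/
def jointErrorProb {Ω ι : Type*} [MeasurableSpace Ω] [Fintype ι] [DecidableEq ι]
    (μ : Measure Ω) (X : ℝ → Ω → ι) (ε : ι → ℝ) {M N : ℕ} (dec : Decoder ι M N) (k : Fin M)
    (i j : ι) : ℝ :=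
  ∑ s : Fin (N + 1) → ι with s (Fin.last N) = j,
    (μ[|{ω | X 0 ω = i}]).real {ω | ∀ n : Fin (N + 1), X ((n : ℝ) / N) ω = s n} *
      errorGivenStates ε dec k s

/-- The function `w ↦ min {1, e^{-N (w - ρ R)}}`. -/
def boundFun (N : ℕ) (ρ R w : ℝ) : ℝ := min 1 (Real.exp (-(N * (w - ρ * R))))

end RareTransition

end

open RareTransition

/-!
Conditionally on the state sequence, Gallager's random-coding argument bounds the error
probability by `g_N` evaluated at the sampled weighted occupation time `W_N`; averaging over the
states gives the first claim.

For the limits, dominated convergence applies since `g_N ≤ 1`. The paths are step functions, so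
`W_N → W` almost surely, and `g_N` tends to the indicator of `(-∞, ρ R]` locally uniformly away
from `w = ρ R`. The jump of the indicator is harmless: given the visited states, `W` is an affine
function of independent atomless holding times, so almost surely `W = ρ R` is possible only when
this function is constant, that is, when all the states visited during `[0, 1)` have the same
value of `b`, and then `W_N = W`.
-/

namespace RareTransition

/-! ### Gallager's random-coding bound -/

section RandomCoding

variable {A B κ : Type*}

section CommSemiring

variable {S : Type*} [CommSemiring S] [Fintype A] [Fintype κ] [DecidableEq κ] {p : A → S}

lemma sum_prod_apply_eq_one (hp : ∑ x, p x = 1) : ∑ c : κ → A, ∏ l, p (c l) = 1 := by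
  rw [← Fintype.prod_sum fun _ : κ => p, Finset.prod_eq_one fun _ _ => hp]

lemma sum_prod_mul_apply_mul_restrict (p F : A → S) (k : κ) (G : ({l // l ≠ k} → A) → S) :
    ∑ c : κ → A, (∏ l, p (c l)) * (F (c k) * G fun l => c l) =
      (∑ x, p x * F x) * ∑ c : {l // l ≠ k} → A, (∏ l, p (c l)) * G c := by
  rw [Finset.sum_mul_sum, ← Fintype.sum_prod_type', ← (Equiv.funSplitAt k A).sum_comp]
  refine Finset.sum_congr rfl fun c _ => ?_
  rw [Fintype.prod_eq_mul_prod_subtype_ne (fun l => p (c l)) k]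
  exact mul_mul_mul_comm _ _ _ _

lemma sum_prod_mul_apply (hp : ∑ x, p x = 1) (F : A → S) (k : κ) :
    ∑ c : κ → A, (∏ l, p (c l)) * F (c k) = ∑ x, p x * F x := by
  simpa [sum_prod_apply_eq_one hp] using sum_prod_mul_apply_mul_restrict p F k fun _ => 1

end CommSemiring

variable {p : A → ℝ} {ρ : ℝ}

lemma sum_prod_mul_rpow_sum_le [Fintype A] [Fintype κ] [DecidableEq κ] (hp0 : ∀ x, 0 ≤ p x)
    (hp1 : ∑ x, p x = 1) {h : A → ℝ} (h0 : ∀ x, 0 ≤ h x) (hρ0 : 0 ≤ ρ) (hρ1 : ρ ≤ 1) :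
    ∑ c : κ → A, (∏ l, p (c l)) * (∑ l, h (c l)) ^ ρ ≤
      (Fintype.card κ * ∑ x, p x * h x) ^ ρ := by
  have jensen := (Real.concaveOn_rpow hρ0 hρ1).le_map_sum (t := Finset.univ)
    (w := fun c : κ → A => ∏ l, p (c l)) (p := fun c => ∑ l, h (c l))
    (fun c _ => Finset.prod_nonneg fun l _ => hp0 _) (sum_prod_apply_eq_one hp1)
    (fun c _ => Finset.sum_nonneg fun l _ => h0 _)
  simp only [smul_eq_mul] at jensen
  refine jensen.trans_eq ?_
  simp only [Finset.mul_sum]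
  rw [Finset.sum_comm]
  simp [sum_prod_mul_apply hp1, Finset.mul_sum]

lemma le_rpow_mul_rpow {u v : ℝ} (hu : 0 ≤ u) (huv : u ≤ v) (hρ : 0 ≤ ρ) :
    u ≤ u ^ (1 / (1 + ρ)) * (v ^ (1 / (1 + ρ))) ^ ρ := by
  calc u = u ^ (1 / (1 + ρ)) * (u ^ (1 / (1 + ρ))) ^ ρ := by
        rw [← Real.rpow_mul hu, ← Real.rpow_add_of_nonneg hu (by positivity) (by positivity),
          ← mul_one_add, one_div_mul_cancel (by positivity), Real.rpow_one]
    _ ≤ u ^ (1 / (1 + ρ)) * (v ^ (1 / (1 + ρ))) ^ ρ := by gcongr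

variable [Fintype κ] [DecidableEq κ] {L : A → B → ℝ} {k : κ} {correct : (κ → A) → B → Prop}
  [∀ c y, Decidable (correct c y)]

lemma mul_error_le_rpow_mul_rpow_sum (hL : ∀ x y, 0 ≤ L x y)
    (hk : ∀ c y, ¬correct c y → ∃ l ≠ k, L (c k) y ≤ L (c l) y) (hρ : 0 ≤ ρ) (c : κ → A) (y : B) :
    L (c k) y * (if correct c y then 0 else 1) ≤
      L (c k) y ^ (1 / (1 + ρ)) * (∑ l : {l // l ≠ k}, L (c l) y ^ (1 / (1 + ρ))) ^ ρ := by
  have hLa : ∀ x, 0 ≤ L x y ^ (1 / (1 + ρ)) := fun x => Real.rpow_nonneg (hL x y) _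
  split_ifs with hc
  · rw [mul_zero]
    exact mul_nonneg (hLa _) (Real.rpow_nonneg (Finset.sum_nonneg fun l _ => hLa _) _)
  · obtain ⟨l, hlk, hl⟩ := hk c y hc
    rw [mul_one]
    refine (le_rpow_mul_rpow (hL _ _) hl hρ).trans ?_
    gcongr
    · exact hLa _
    · exact hLa _
    · exact Finset.single_le_sum (f := fun l : {l // l ≠ k} => L (c l) y ^ (1 / (1 + ρ)))
        (fun l _ => hLa _) (Finset.mem_univ ⟨l, hlk⟩)

theorem sum_prod_mul_sum_error_le [Fintype A] [Fintype B] (hp0 : ∀ x, 0 ≤ p x) (hp1 : ∑ x, p x = 1)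
    (hL : ∀ x y, 0 ≤ L x y) (hk : ∀ c y, ¬correct c y → ∃ l ≠ k, L (c k) y ≤ L (c l) y)
    (hρ0 : 0 ≤ ρ) (hρ1 : ρ ≤ 1) :
    ∑ c : κ → A, (∏ l, p (c l)) * ∑ y, L (c k) y * (if correct c y then 0 else 1) ≤
      (Fintype.card κ - 1 : ℝ) ^ ρ * ∑ y, (∑ x, p x * L x y ^ (1 / (1 + ρ))) ^ (1 + ρ) := by
  set a := 1 / (1 + ρ)
  have hLa : ∀ x y, 0 ≤ L x y ^ a := fun x y => Real.rpow_nonneg (hL x y) _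
  have hE : ∀ y, 0 ≤ ∑ x, p x * L x y ^ a := fun y =>
    Finset.sum_nonneg fun x _ => mul_nonneg (hp0 x) (hLa x y)
  have hcard : (Fintype.card {l // l ≠ k} : ℝ) = Fintype.card κ - 1 := by
    rw [Fintype.card_subtype_compl, Fintype.card_subtype_eq,
      Nat.cast_pred (Fintype.card_pos_iff.2 ⟨k⟩)]
  calc _ ≤ ∑ c : κ → A, (∏ l, p (c l)) *
          ∑ y, L (c k) y ^ a * (∑ l : {l // l ≠ k}, L (c l) y ^ a) ^ ρ :=
        Finset.sum_le_sum fun c _ => mul_le_mul_of_nonneg_left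
          (Finset.sum_le_sum fun y _ => mul_error_le_rpow_mul_rpow_sum hL hk hρ0 c y)
          (Finset.prod_nonneg fun l _ => hp0 _)
    _ = ∑ y, ∑ c : κ → A, (∏ l, p (c l)) *
          (L (c k) y ^ a * (∑ l : {l // l ≠ k}, L (c l) y ^ a) ^ ρ) := by
        simp only [Finset.mul_sum]
        exact Finset.sum_comm
    _ = ∑ y, (∑ x, p x * L x y ^ a) *
          ∑ c : {l // l ≠ k} → A, (∏ l, p (c l)) * (∑ l, L (c l) y ^ a) ^ ρ :=
        Finset.sum_congr rfl fun y _ => sum_prod_mul_apply_mul_restrict p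
          (fun x => L x y ^ a) k fun c => (∑ l, L (c l) y ^ a) ^ ρ
    _ ≤ ∑ y, (∑ x, p x * L x y ^ a) * ((Fintype.card κ - 1) * ∑ x, p x * L x y ^ a) ^ ρ := by
        rw [← hcard]
        exact Finset.sum_le_sum fun y _ => mul_le_mul_of_nonneg_left
          (sum_prod_mul_rpow_sum_le hp0 hp1 (h := fun x => L x y ^ a) (hLa · y) hρ0 hρ1) (hE y)
    _ = _ := by
        rw [Finset.mul_sum]
        refine Finset.sum_congr rfl fun y _ => ?_
        rw [Real.mul_rpow (hcard ▸ Nat.cast_nonneg _) (hE y),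
          Real.rpow_one_add' (hE y) (by positivity), mul_left_comm]

lemma sum_rpow_sum_prod_eq_prod {ν : Type*} [Fintype ν] [DecidableEq ν] [Fintype A]
    [Fintype B] (hp0 : ∀ x, 0 ≤ p x) {P : ν → A → B → ℝ} (hP : ∀ n x y, 0 ≤ P n x y) (a s : ℝ) :
    ∑ y : ν → B, (∑ x : ν → A, (∏ n, p (x n)) * (∏ n, P n (x n) (y n)) ^ a) ^ s =
      ∏ n, ∑ z, (∑ x, p x * P n x z ^ a) ^ s := by
  have hsum : ∀ y : ν → B, ∑ x : ν → A, (∏ n, p (x n)) * (∏ n, P n (x n) (y n)) ^ a =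
      ∏ n, ∑ x, p x * P n x (y n) ^ a := fun y => by
    rw [Fintype.prod_sum]
    simp only [Finset.prod_mul_distrib, Real.finsetProd_rpow _ _ fun n _ => hP n _ _]
  simp only [hsum]
  rw [Fintype.prod_sum]
  refine Finset.sum_congr rfl fun y _ => (Real.finsetProd_rpow _ _ (fun n _ => ?_) s).symm
  exact Finset.sum_nonneg fun x _ => mul_nonneg (hp0 x) (Real.rpow_nonneg (hP n x _) _)

end RandomCoding

/-! ### The binary symmetric channel -/

section BinarySymmetricChannel

variable {e ρ : ℝ}

lemma bscProb_nonneg (he : e ∈ Set.Icc 0 1) (x y : Bool) : 0 ≤ bscProb e x y := by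
  unfold bscProb
  split_ifs <;> linarith [he.1, he.2]

lemma sum_bscProb (e : ℝ) (x : Bool) : ∑ y, bscProb e x y = 1 := by
  cases x <;> simp [bscProb]

lemma rpow_add_one_sub_rpow_pos (he : e ∈ Set.Icc 0 1) (a : ℝ) : 0 < e ^ a + (1 - e) ^ a := by
  rcases he.1.eq_or_lt with rfl | h0
  · rw [sub_zero, Real.one_rpow]
    exact add_pos_of_nonneg_of_pos (Real.rpow_nonneg le_rfl a) one_pos
  · exact add_pos_of_pos_of_nonneg (Real.rpow_pos_of_pos h0 a)
      (Real.rpow_nonneg (sub_nonneg.2 he.2) a)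

lemma exp_neg_bscExponent (he : e ∈ Set.Icc 0 1) (ρ : ℝ) :
    Real.exp (-bscExponent e ρ) =
      1 / (2 : ℝ) ^ ρ * (e ^ (1 / (1 + ρ)) + (1 - e) ^ (1 / (1 + ρ))) ^ (1 + ρ) := by
  have := rpow_add_one_sub_rpow_pos he (1 / (1 + ρ))
  rw [bscExponent, neg_neg, Real.exp_log (by positivity)]

lemma sum_rpow_sum_bscProb (he : e ∈ Set.Icc 0 1) (hρ : 0 ≤ ρ) :
    ∑ y, (∑ x, 1 / 2 * bscProb e x y ^ (1 / (1 + ρ))) ^ (1 + ρ) =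
      Real.exp (-bscExponent e ρ) := by
  set S := e ^ (1 / (1 + ρ)) + (1 - e) ^ (1 / (1 + ρ)) with hS
  have hinner : ∀ y, ∑ x, 1 / 2 * bscProb e x y ^ (1 / (1 + ρ)) = 1 / 2 * S := by
    intro y
    cases y <;> simp only [Fintype.sum_bool, bscProb, hS, reduceCtorEq, if_true, if_false] <;> ring
  simp only [hinner, Fintype.sum_bool, exp_neg_bscExponent he, ← hS]
  rw [Real.mul_rpow (by norm_num) (rpow_add_one_sub_rpow_pos he _).le,
    Real.div_rpow zero_le_one zero_le_two, Real.one_rpow,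
    Real.rpow_one_add' zero_le_two (by positivity)]
  field_simp
  ring

variable {ι : Type*} {N M : ℕ} {ε : ι → ℝ}

lemma likelihood_nonneg (hε : ∀ s, ε s ∈ Set.Icc 0 1) (s : Fin (N + 1) → ι) (x y : Fin N → Bool) :
    0 ≤ likelihood ε s x y :=
  Finset.prod_nonneg fun _ _ => bscProb_nonneg (hε _) _ _

lemma sum_likelihood (ε : ι → ℝ) (s : Fin (N + 1) → ι) (x : Fin N → Bool) :
    ∑ y, likelihood ε s x y = 1 := by
  unfold likelihood
  rw [← Fintype.prod_sum fun n z => bscProb (ε (s n.castSucc)) (x n) z]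
  exact Finset.prod_eq_one fun n _ => sum_bscProb _ _

lemma IsMaximumLikelihood.exists_le {dec : Decoder ι M N} (hdec : IsMaximumLikelihood ε dec)
    {k : Fin M} {s : Fin (N + 1) → ι} {c : Codebook M N} {y : Fin N → Bool}
    (h : dec s c y ≠ some k) : ∃ l ≠ k, likelihood ε s (c k) y ≤ likelihood ε s (c l) y := by
  obtain ⟨hsome, hnone⟩ := hdec s c y
  cases hd : dec s c y with
  | none =>
    obtain ⟨l, l', hne, hl, hl'⟩ := hnone hd
    by_cases hk : l = k
    · exact ⟨l', fun h => hne (hk.trans h.symm), hl' k⟩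
    · exact ⟨l, hk, hl k⟩
  | some l => exact ⟨l, fun hk => h (hk ▸ hd), hsome l hd k⟩

lemma sum_uniform_codeword : ∑ _x : Fin N → Bool, ∏ _n : Fin N, (1 / 2 : ℝ) = 1 :=
  sum_prod_apply_eq_one (p := fun _ : Bool => (1 / 2 : ℝ)) (by norm_num)

lemma errorGivenStates_le_one (hε : ∀ s, ε s ∈ Set.Icc 0 1) (dec : Decoder ι M N) (k : Fin M)
    (s : Fin (N + 1) → ι) : errorGivenStates ε dec k s ≤ 1 := by
  have hnoise : ∀ c : Codebook M N,
      ∑ y, likelihood ε s (c k) y * (if dec s c y = some k then 0 else 1) ≤ 1 := fun c => by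
    refine (Finset.sum_le_sum fun y _ => ?_).trans (sum_likelihood ε s (c k)).le
    refine mul_le_of_le_one_right (likelihood_nonneg hε _ _ _) ?_
    split_ifs <;> norm_num
  calc errorGivenStates ε dec k s ≤ ∑ c : Codebook M N, codebookProb c :=
        Finset.sum_le_sum fun c _ =>
          mul_le_of_le_one_right (by unfold codebookProb; positivity) (hnoise c)
    _ = 1 := sum_prod_apply_eq_one (κ := Fin M) sum_uniform_codeword

lemma errorGivenStates_le_rpow_mul_exp (hε : ∀ s, ε s ∈ Set.Icc 0 1) {dec : Decoder ι M N}
    (hdec : IsMaximumLikelihood ε dec) (k : Fin M) (s : Fin (N + 1) → ι) (hρ0 : 0 ≤ ρ)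
    (hρ1 : ρ ≤ 1) :
    errorGivenStates ε dec k s ≤
      (M - 1 : ℝ) ^ ρ * Real.exp (-∑ n : Fin N, bscExponent (ε (s n.castSucc)) ρ) := by
  have hgallager := sum_prod_mul_sum_error_le (correct := fun c y => dec s c y = some k)
    (p := fun _ : Fin N → Bool => ∏ _n : Fin N, (1 / 2 : ℝ)) (fun _ => by positivity)
    sum_uniform_codeword (likelihood_nonneg hε s) (fun c y h => hdec.exists_le h) hρ0 hρ1
  refine hgallager.trans_eq ?_
  have hletters := sum_rpow_sum_prod_eq_prod (p := fun _ : Bool => (1 / 2 : ℝ))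
    (P := fun (n : Fin N) x y => bscProb (ε (s n.castSucc)) x y) (fun _ => by norm_num)
    (fun n x y => bscProb_nonneg (hε _) x y) (1 / (1 + ρ)) (1 + ρ)
  simp only [sum_rpow_sum_bscProb (hε _) hρ0] at hletters
  rw [Fintype.card_fin, ← Finset.sum_neg_distrib, Real.exp_sum, ← hletters]
  rfl

theorem errorGivenStates_le_boundFun (hε : ∀ s, ε s ∈ Set.Icc 0 1) (hN : N ≠ 0) {R : ℝ}
    (hM : (M : ℝ) < Real.exp (N * R) + 1) {dec : Decoder ι M N}
    (hdec : IsMaximumLikelihood ε dec) (k : Fin M) (s : Fin (N + 1) → ι) (hρ0 : 0 ≤ ρ)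
    (hρ1 : ρ ≤ 1) :
    errorGivenStates ε dec k s ≤
      boundFun N ρ R ((∑ n : Fin N, bscExponent (ε (s n.castSucc)) ρ) / N) := by
  refine le_min (errorGivenStates_le_one hε dec k s)
    ((errorGivenStates_le_rpow_mul_exp hε hdec k s hρ0 hρ1).trans ?_)
  have hM1 : (1 : ℝ) ≤ M := by exact_mod_cast k.pos
  calc (M - 1 : ℝ) ^ ρ * Real.exp (-∑ n : Fin N, bscExponent (ε (s n.castSucc)) ρ)
      ≤ Real.exp (N * R) ^ ρ * Real.exp (-∑ n : Fin N, bscExponent (ε (s n.castSucc)) ρ) := by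
        gcongr
        linarith
    _ = _ := by
        rw [← Real.exp_mul, ← Real.exp_add]
        congr 1
        field_simp
        ring

lemma monotoneOn_add_apply_one_sub {f : ℝ → ℝ} (hf : ConcaveOn ℝ (Set.Icc 0 1) f) :
    MonotoneOn (fun x => f x + f (1 - x)) (Set.Icc 0 (1 / 2)) := by
  rintro x ⟨hx0, hx⟩ y ⟨_, hy⟩ hxy
  have hconc : ConcaveOn ℝ (Set.Icc 0 1) fun x => f x + f (1 - x) := by
    have hrefl := hf.comp_affineMap (AffineMap.const ℝ ℝ 1 - AffineMap.id ℝ ℝ)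
    refine hf.add ((hrefl.subset (fun z hz => ?_) (convex_Icc 0 1)).congr fun z _ => rfl)
    exact ⟨sub_nonneg.2 hz.2, sub_le_self _ hz.1⟩
  have hmem : y ∈ segment ℝ x (1 - x) := by
    rw [segment_eq_Icc (by linarith)]
    exact ⟨hxy, by linarith⟩
  have hge := hconc.ge_on_segment ⟨hx0, by linarith⟩ ⟨by linarith, by linarith⟩ hmem
  rwa [sub_sub_cancel, add_comm (f (1 - x)), min_self] at hge

lemma antitoneOn_bscExponent (hρ : 0 ≤ ρ) :
    AntitoneOn (fun e => bscExponent e ρ) (Set.Icc 0 (1 / 2)) := by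
  have hmono := monotoneOn_add_apply_one_sub <|
    (Real.concaveOn_rpow (p := 1 / (1 + ρ)) (by positivity)
      (div_le_one_of_le₀ (by linarith) (by positivity))).subset
      Set.Icc_subset_Ici_self (convex_Icc 0 1)
  have hsub : Set.Icc (0 : ℝ) (1 / 2) ⊆ Set.Icc 0 1 := Set.Icc_subset_Icc_right (by norm_num)
  intro x hx y hy hxy
  rw [← neg_le_neg_iff, ← Real.exp_le_exp, exp_neg_bscExponent (hsub hx),
    exp_neg_bscExponent (hsub hy)]
  have := (rpow_add_one_sub_rpow_pos (hsub hx) (1 / (1 + ρ))).le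
  gcongr ?_ * ?_ ^ _
  exact hmono hx hy hxy

lemma bscExponent_mem_Icc_last_zero {m : ℕ} {ε : Fin (m + 1) → ℝ} (hε : Monotone ε)
    (hε' : ∀ s, ε s ∈ Set.Icc 0 (1 / 2)) (hρ : 0 ≤ ρ) (s : Fin (m + 1)) :
    bscExponent (ε s) ρ ∈ Set.Icc (bscExponent (ε (Fin.last m)) ρ) (bscExponent (ε 0) ρ) :=
  ⟨antitoneOn_bscExponent hρ (hε' s) (hε' _) (hε s.le_last),
    antitoneOn_bscExponent hρ (hε' 0) (hε' s) (hε s.zero_le)⟩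

end BinarySymmetricChannel

/-! ### Limits of the bounding functions -/

section BoundFun

variable {ρ R w : ℝ} {u : ℕ → ℝ}

lemma boundFun_nonneg (N : ℕ) (ρ R w : ℝ) : 0 ≤ boundFun N ρ R w :=
  le_min zero_le_one (Real.exp_pos _).le

lemma norm_boundFun_le_one (N : ℕ) (ρ R w : ℝ) : ‖boundFun N ρ R w‖ ≤ 1 := by
  rw [Real.norm_of_nonneg (boundFun_nonneg _ _ _ _)]
  exact min_le_left _ _

lemma measurable_boundFun (N : ℕ) (ρ R : ℝ) : Measurable (boundFun N ρ R) := by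
  unfold boundFun
  fun_prop

lemma boundFun_eq_one (N : ℕ) (h : w ≤ ρ * R) : boundFun N ρ R w = 1 :=
  min_eq_left <| Real.one_le_exp <| neg_nonneg.2 <|
    mul_nonpos_of_nonneg_of_nonpos N.cast_nonneg (sub_nonpos.2 h)

lemma tendsto_boundFun_of_gt (hu : Tendsto u atTop (𝓝 w)) (h : ρ * R < w) :
    Tendsto (fun N => boundFun N ρ R (u N)) atTop (𝓝 0) := by
  have hexp : Tendsto (fun N : ℕ => Real.exp (-(N * (u N - ρ * R)))) atTop (𝓝 0) :=
    Real.tendsto_exp_neg_atTop_nhds_zero.comp <|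
      tendsto_natCast_atTop_atTop.atTop_mul_pos (sub_pos.2 h) (hu.sub_const _)
  exact squeeze_zero (fun N => boundFun_nonneg _ _ _ _) (fun N => min_le_right _ _) hexp

lemma tendsto_boundFun (hu : Tendsto u atTop (𝓝 w))
    (hjump : w = ρ * R → ∀ᶠ N in atTop, u N = ρ * R) :
    Tendsto (fun N => boundFun N ρ R (u N)) atTop
      (𝓝 ((Set.Iic (ρ * R)).indicator (fun _ => (1 : ℝ)) w)) := by
  rcases lt_or_ge (ρ * R) w with hw | hw
  · rw [Set.indicator_of_notMem (Set.notMem_Iic.2 hw)]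
    exact tendsto_boundFun_of_gt hu hw
  · rw [Set.indicator_of_mem (Set.mem_Iic.2 hw)]
    have hle : ∀ᶠ N in atTop, u N ≤ ρ * R := by
      rcases hw.eq_or_lt with hw | hw
      · exact (hjump hw).mono fun N => le_of_eq
      · exact (hu.eventually_lt_const hw).mono fun N => le_of_lt
    exact tendsto_const_nhds.congr' (hle.mono fun N hN => (boundFun_eq_one N hN).symm)

lemma tendsto_integral_boundFun {Ω : Type*} [MeasurableSpace Ω] {ν : Measure Ω}
    [IsFiniteMeasure ν] {WN : ℕ → Ω → ℝ} {W : Ω → ℝ}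
    (hmeas : ∀ᶠ N in atTop, AEMeasurable (WN N) ν)
    (hlim : ∀ᵐ ω ∂ν, Tendsto (WN · ω) atTop (𝓝 (W ω)))
    (hjump : ∀ᵐ ω ∂ν, W ω = ρ * R → ∀ᶠ N in atTop, WN N ω = ρ * R) :
    Tendsto (fun N => ∫ ω, boundFun N ρ R (WN N ω) ∂ν) atTop
      (𝓝 (∫ ω, (Set.Iic (ρ * R)).indicator (fun _ => (1 : ℝ)) (W ω) ∂ν)) := by
  refine tendsto_integral_filter_of_dominated_convergence (fun _ => 1) ?_
    (.of_forall fun N => .of_forall fun ω => norm_boundFun_le_one _ _ _ _)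
    (integrable_const _) ?_
  · filter_upwards [hmeas] with N hN
    exact ((measurable_boundFun N ρ R).comp_aemeasurable hN).aestronglyMeasurable
  · filter_upwards [hlim, hjump] with ω using tendsto_boundFun

end BoundFun

/-! ### Occupation times of step paths -/

lemma exists_lt_le_lt_succ {α : Type*} [LinearOrder α] {a : ℕ → α} {t : α} {n : ℕ}
    (h0 : a 0 ≤ t) (hn : t < a n) : ∃ k < n, a k ≤ t ∧ t < a (k + 1) := by
  induction n with
  | zero => exact absurd hn h0.not_gt
  | succ n ih =>
    rcases le_or_gt (a n) t with h | h
    · exact ⟨n, n.lt_succ_self, h, hn⟩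
    · obtain ⟨k, hk, hkt⟩ := ih h
      exact ⟨k, hk.trans n.lt_succ_self, hkt⟩

lemma integral_eq_sum_of_eqOn_Ico {g : ℝ → ℝ} {a : ℕ → ℝ} (ha : Monotone a) {c : ℕ → ℝ} {n : ℕ}
    (hg : ∀ k < n, ∀ t ∈ Set.Ico (a k) (a (k + 1)), g t = c k) :
    ∫ t in a 0..a n, g t = ∑ k ∈ Finset.range n, (a (k + 1) - a k) * c k := by
  have hIoo : ∀ k < n, Set.EqOn g (fun _ => c k) (Set.Ioo (a k) (a (k + 1))) :=
    fun k hk t ht => hg k hk t (Set.Ioo_subset_Ico_self ht)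
  have hint : ∀ k < n, IntervalIntegrable g volume (a k) (a (k + 1)) := fun k hk =>
    intervalIntegrable_const.congr_uIoo fun t ht => by
      rw [Set.uIoo_of_le (ha k.le_succ)] at ht
      exact (hIoo k hk ht).symm
  rw [← intervalIntegral.sum_integral_adjacent_intervals hint]
  refine Finset.sum_congr rfl fun k hk => ?_
  rw [intervalIntegral.integral_congr_Ioo_of_le (ha k.le_succ) (hIoo k (Finset.mem_range.1 hk))]
  simp

/-- The path `x`, restricted to `[0, 1)`, is a step function with `n` steps: it sits in `y k`
from the time `a k` until just before `a (k + 1)`. Steps may be empty, and the values of `y` and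
`a` beyond the index `n` are irrelevant. -/
structure IsStepPath {ι : Type*} (x : ℝ → ι) (y : ℕ → ι) (a : ℕ → ℝ) (n : ℕ) : Prop where
  mono : Monotone a
  zero : a 0 = 0
  one : a n = 1
  eq : ∀ k < n, ∀ t ∈ Set.Ico (a k) (a (k + 1)), x t = y k

/-- The path `x` follows the states `y` with the holding times `T`: it sits in `y n` from the
`n`-th jump time until just before the next one. This is the pathwise condition of `IsCTMC`. -/
def IsJumpPath {ι : Type*} (x : ℝ → ι) (y : ℕ → ι) (T : ℕ → ℝ≥0∞) : Prop :=
  ∀ t : ℝ, 0 ≤ t → ∀ n : ℕ, ∑ k ∈ Finset.range n, T k ≤ ENNReal.ofReal t →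
    ENNReal.ofReal t < ∑ k ∈ Finset.range (n + 1), T k → x t = y n

section StepPath

variable {Ω ι : Type*} {x : ℝ → ι} {y : ℕ → ι} {a : ℕ → ℝ} {n N : ℕ} {X : ℝ → Ω → ι} {ω : Ω}

lemma IsStepPath.exists_mem_Ico (h : IsStepPath x y a n) {t : ℝ} (ht : t ∈ Set.Ico (0 : ℝ) 1) :
    ∃ k < n, t ∈ Set.Ico (a k) (a (k + 1)) :=
  exists_lt_le_lt_succ (h.zero.trans_le ht.1) (ht.2.trans_eq h.one.symm)

lemma IsStepPath.sum_length (h : IsStepPath x y a n) :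
    ∑ k ∈ Finset.range n, (a (k + 1) - a k) = 1 := by
  rw [Finset.sum_range_sub, h.one, h.zero, sub_zero]

lemma floor_natCast_mul_eq (hN : N ≠ 0) {k : ℕ} {t : ℝ}
    (ht : t ∈ Set.Ico ((k : ℝ) / N) (((k + 1 : ℕ) : ℝ) / N)) : ⌊(N : ℝ) * t⌋ = k := by
  have hN' : (0 : ℝ) < N := by positivity
  obtain ⟨hkt, htk⟩ := ht
  rw [div_le_iff₀' hN'] at hkt
  rw [lt_div_iff₀' hN'] at htk
  exact Int.floor_eq_iff.2 ⟨by exact_mod_cast hkt, by exact_mod_cast htk⟩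

lemma isStepPath_sampled (X : ℝ → Ω → ι) (ω : Ω) (hN : N ≠ 0) :
    IsStepPath (fun t => sampled N X t ω) (fun k => X ((k : ℝ) / N) ω)
      (fun k => (k : ℝ) / N) N where
  mono k l hkl := by
    dsimp only
    gcongr
  zero := by simp
  one := div_self (by positivity)
  eq k _ t ht := by simp only [sampled, floor_natCast_mul_eq hN ht, Int.cast_natCast]

lemma sampled_zero (N : ℕ) (X : ℝ → Ω → ι) : sampled N X 0 = X 0 := by simp [sampled]

lemma sampled_one (hN : N ≠ 0) (X : ℝ → Ω → ι) : sampled N X 1 = X 1 := by simp [sampled, hN]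

lemma tendsto_floor_natCast_mul_div (t : ℝ) :
    Tendsto (fun N : ℕ => (⌊(N : ℝ) * t⌋ : ℝ) / N) atTop (𝓝 t) := by
  have hlower : Tendsto (fun N : ℕ => t - 1 / (N : ℝ)) atTop (𝓝 t) := by
    simpa using (tendsto_const_nhds (x := t)).sub (tendsto_const_div_atTop_nhds_zero_nat (1 : ℝ))
  refine tendsto_of_tendsto_of_tendsto_of_le_of_le' hlower tendsto_const_nhds ?_ ?_
  all_goals
    filter_upwards [eventually_ne_atTop 0] with N hN
    have hN' : (0 : ℝ) < N := by positivity
  · rw [le_div_iff₀ hN', sub_mul, one_div_mul_cancel hN'.ne']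
    linarith [Int.sub_one_lt_floor ((N : ℝ) * t)]
  · rw [div_le_iff₀ hN']
    linarith [Int.floor_le ((N : ℝ) * t)]

lemma IsJumpPath.isStepPath {T : ℕ → ℝ≥0∞} (h : IsJumpPath x y T)
    (hn : 1 ≤ ∑ k ∈ Finset.range n, T k) :
    IsStepPath x y (fun n => (min (∑ k ∈ Finset.range n, T k) 1).toReal) n where
  mono k l hkl := by
    refine ENNReal.toReal_mono (by simp) (min_le_min_right _ ?_)
    exact Finset.sum_le_sum_of_subset (Finset.range_mono hkl)
  zero := by simp
  one := by simp [hn]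
  eq k _ t ht := by
    have h0 : 0 ≤ t := ENNReal.toReal_nonneg.trans ht.1
    have hlt : ENNReal.ofReal t < min (∑ k ∈ Finset.range (k + 1), T k) 1 :=
      (ENNReal.ofReal_lt_iff_lt_toReal h0 (by simp)).2 ht.2
    have hge : min (∑ k ∈ Finset.range k, T k) 1 ≤ ENNReal.ofReal t :=
      (ENNReal.le_ofReal_iff_toReal_le (by simp) h0).2 ht.1
    refine h t h0 k ?_ (hlt.trans_le (min_le_left _ _))
    exact (min_le_iff.1 hge).resolve_right (hlt.trans_le (min_le_right _ _)).not_ge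

variable [Fintype ι] [DecidableEq ι] {b : ι → ℝ}

lemma IsStepPath.weightedOccupation_eq_sum (h : IsStepPath (X · ω) y a n) (b : ι → ℝ) :
    weightedOccupation b X ω = ∑ k ∈ Finset.range n, (a (k + 1) - a k) * b (y k) := by
  have hocc : ∀ i, occupationTime X i ω =
      ∑ k ∈ Finset.range n, (a (k + 1) - a k) * (if y k = i then 1 else 0) := fun i => by
    rw [occupationTime, ← h.zero, ← h.one]
    exact integral_eq_sum_of_eqOn_Ico h.mono fun k hk t ht => by rw [h.eq k hk t ht]
  simp only [weightedOccupation, hocc, Finset.sum_mul]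
  rw [Finset.sum_comm]
  simp

lemma IsStepPath.weightedOccupation_mem (h : IsStepPath (X · ω) y a n) {C : Set ℝ}
    (hC : Convex ℝ C) (hb : ∀ s, b s ∈ C) : weightedOccupation b X ω ∈ C := by
  rw [h.weightedOccupation_eq_sum]
  exact hC.sum_mem (fun k _ => sub_nonneg.2 (h.mono k.le_succ)) h.sum_length fun k _ => hb _

lemma IsStepPath.weightedOccupation_eq_of_forall (h : IsStepPath (X · ω) y a n) {c : ℝ}
    (hc : ∀ k < n, b (y k) = c) : weightedOccupation b X ω = c := by
  rw [h.weightedOccupation_eq_sum, Finset.sum_congr rfl fun k hk => by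
    rw [hc k (Finset.mem_range.1 hk)], ← Finset.sum_mul, h.sum_length, one_mul]

lemma weightedOccupation_sampled (b : ι → ℝ) (X : ℝ → Ω → ι) (ω : Ω) (hN : N ≠ 0) :
    weightedOccupation b (sampled N X) ω = (∑ n : Fin N, b (X ((n : ℝ) / N) ω)) / N := by
  rw [(isStepPath_sampled X ω hN).weightedOccupation_eq_sum, Finset.sum_div, Finset.sum_range]
  refine Finset.sum_congr rfl fun k _ => ?_
  push_cast
  ring

lemma IsStepPath.weightedOccupation_sampled_eq_of_forall (h : IsStepPath (X · ω) y a n) {c : ℝ}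
    (hc : ∀ k < n, b (y k) = c) (hN : N ≠ 0) : weightedOccupation b (sampled N X) ω = c := by
  refine (isStepPath_sampled X ω hN).weightedOccupation_eq_of_forall fun l hl => ?_
  have hlN : (l : ℝ) / N ∈ Set.Ico (0 : ℝ) 1 :=
    ⟨by positivity, (div_lt_one (by positivity)).2 (by exact_mod_cast hl)⟩
  obtain ⟨k, hk, hkt⟩ := h.exists_mem_Ico hlN
  exact (congrArg b (h.eq k hk _ hkt)).trans (hc k hk)

lemma IsStepPath.tendsto_weightedOccupation_sampled (h : IsStepPath (X · ω) y a n) (b : ι → ℝ) :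
    Tendsto (fun N => weightedOccupation b (sampled N X) ω) atTop
      (𝓝 (weightedOccupation b X ω)) := by
  refine tendsto_finsetSum _ fun i _ => Tendsto.mul_const _ ?_
  refine intervalIntegral.tendsto_integral_filter_of_dominated_convergence (fun _ => 1)
    (.of_forall fun N => Measurable.aestronglyMeasurable ?_)
    (.of_forall fun N => .of_forall fun t _ => ?_) intervalIntegrable_const ?_
  · have hstate : Measurable fun z : ℤ => if X ((z : ℝ) / N) ω = i then (1 : ℝ) else 0 :=
      measurable_from_top
    exact hstate.comp (Int.measurable_floor.comp (measurable_const_mul (N : ℝ)))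
  · split_ifs <;> simp
  · filter_upwards [(Set.countable_range a).ae_notMem volume] with t hta ht
    rw [Set.uIoc_of_le zero_le_one] at ht
    have ht1 : t ≠ 1 := fun h1 => hta ⟨n, h.one.trans h1.symm⟩
    obtain ⟨k, hk, hkt⟩ := h.exists_mem_Ico ⟨ht.1.le, ht.2.lt_of_ne ht1⟩
    have hIoo : t ∈ Set.Ioo (a k) (a (k + 1)) := ⟨hkt.1.lt_of_ne fun h' => hta ⟨k, h'⟩, hkt.2⟩
    refine tendsto_const_nhds.congr' ?_
    filter_upwards [(tendsto_floor_natCast_mul_div t).eventually_mem (isOpen_Ioo.mem_nhds hIoo)]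
      with N hN
    have hXN : X ((⌊(N : ℝ) * t⌋ : ℝ) / N) ω = y k := h.eq k hk _ (Set.Ioo_subset_Ico_self hN)
    have hX : X t ω = y k := h.eq k hk t hkt
    simp only [sampled, hXN, hX]

lemma IsJumpPath.weightedOccupation_eq_sum {T : ℕ → ℝ≥0∞} (h : IsJumpPath (X · ω) y T) {m : ℕ}
    (hm : ∑ k ∈ Finset.range m, T k ≤ 1) (hm1 : 1 < ∑ k ∈ Finset.range (m + 1), T k) (b : ι → ℝ) :
    weightedOccupation b X ω =
      ∑ k ∈ Finset.range m, (T k).toReal * (b (y k) - b (y m)) + b (y m) := by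
  have hT : ∀ k ∈ Finset.range m, T k ≠ ∞ := fun k hk =>
    ((Finset.single_le_sum (fun _ _ => zero_le) hk).trans hm).trans_lt ENNReal.one_lt_top |>.ne
  have hle : ∀ k ≤ m, min (∑ l ∈ Finset.range k, T l) 1 = ∑ l ∈ Finset.range k, T l := fun k hk =>
    min_eq_left ((Finset.sum_le_sum_of_subset (Finset.range_mono hk)).trans hm)
  have hlength : ∀ k ∈ Finset.range m, (min (∑ l ∈ Finset.range (k + 1), T l) 1).toReal -
      (min (∑ l ∈ Finset.range k, T l) 1).toReal = (T k).toReal := fun k hk => by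
    have hkm := Finset.mem_range.1 hk
    rw [hle k hkm.le, hle (k + 1) hkm, Finset.sum_range_succ, ENNReal.toReal_add _ (hT k hk),
      add_sub_cancel_left]
    exact ENNReal.sum_ne_top.2 fun l hl => hT l (Finset.range_mono hkm.le hl)
  rw [(h.isStepPath hm1.le).weightedOccupation_eq_sum, Finset.sum_range_succ,
    Finset.sum_congr rfl fun k hk => by rw [hlength k hk], min_eq_right hm1.le, hle m le_rfl,
    ENNReal.toReal_sum hT, ENNReal.toReal_one]
  simp only [mul_sub, Finset.sum_sub_distrib, ← Finset.sum_mul]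
  ring

end StepPath

/-! ### The jump matrix -/

section JumpMatrix

variable {ι : Type*} [Fintype ι] {Q : Matrix ι ι ℝ}

lemma IsGenerator.sum_erase [DecidableEq ι] (hQ : IsGenerator Q) (i : ι) :
    ∑ j ∈ Finset.univ.erase i, Q i j = exitRate Q i := by
  have hrow := hQ.row_sum i
  rw [← Finset.add_sum_erase _ _ (Finset.mem_univ i)] at hrow
  rw [exitRate]
  linarith

lemma IsGenerator.exitRate_nonneg (hQ : IsGenerator Q) (i : ι) : 0 ≤ exitRate Q i := by
  classical
  rw [← hQ.sum_erase]
  exact Finset.sum_nonneg fun j hj => hQ.rate_nonneg i j (Finset.ne_of_mem_erase hj).symm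

lemma IsGenerator.jumpMatrix_nonneg [DecidableEq ι] (hQ : IsGenerator Q) (i j : ι) :
    0 ≤ jumpMatrix Q i j := by
  unfold jumpMatrix
  split_ifs with _ _ hij
  any_goals norm_num
  exact div_nonneg (hQ.rate_nonneg i j hij) (hQ.exitRate_nonneg i)

lemma IsGenerator.sum_jumpMatrix [DecidableEq ι] (hQ : IsGenerator Q) (i : ι) :
    ∑ j, jumpMatrix Q i j = 1 := by
  unfold jumpMatrix
  split_ifs with hi
  · simp
  · rw [← Finset.add_sum_erase _ _ (Finset.mem_univ i), if_pos rfl, zero_add,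
      ← div_self hi, ← hQ.sum_erase, Finset.sum_div]
    exact Finset.sum_congr rfl fun j hj => if_neg (Finset.ne_of_mem_erase hj).symm

end JumpMatrix

/-! ### Atoms and independence -/

lemma measure_singleton_eq_zero_of_tendsto_Ioi {α : Type*} [TopologicalSpace α] [LinearOrder α]
    [OrderClosedTopology α] [MeasurableSpace α] [OpensMeasurableSpace α] {ν : Measure α}
    [IsFiniteMeasure ν] {a : α} [(𝓝[<] a).NeBot]
    (h : Tendsto (fun r => ν (Set.Ioi r)) (𝓝[<] a) (𝓝 (ν (Set.Ioi a)))) : ν {a} = 0 := by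
  have hle : ∀ r < a, ν {a} + ν (Set.Ioi a) ≤ ν (Set.Ioi r) := fun r hr => by
    rw [← measure_union (by simp) measurableSet_Ioi, Set.singleton_union, Set.Ioi_insert]
    exact measure_mono (Set.Ici_subset_Ioi.2 hr)
  have hlim := ge_of_tendsto h (eventually_nhdsWithin_of_forall hle)
  exact nonpos_iff_eq_zero.1 <|
    ENNReal.le_of_add_le_add_right (measure_ne_top ν _) (by rwa [zero_add])

section Independence

variable {Ω : Type*} [MeasurableSpace Ω] {P : Measure Ω}

lemma measure_eq_comp_eq_zero_of_indepFun {α β : Type*} [MeasurableSpace α] [MeasurableSpace β]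
    [MeasurableEq β] [IsFiniteMeasure P] {V : Ω → α} {T : Ω → β} (hVT : IndepFun V T P)
    (hV : Measurable V) (hT : Measurable T) {φ : α → β} (hφ : Measurable φ)
    (h : ∀ v, P (T ⁻¹' {φ v}) = 0) : P {ω | T ω = φ (V ω)} = 0 := by
  have hD : MeasurableSet {p : α × β | p.2 = φ p.1} :=
    measurableSet_eq_fun measurable_snd (hφ.comp measurable_fst)
  have hprod := hVT.map_prod_eq_prod_map_map hV.aemeasurable hT.aemeasurable
  change P ((fun ω => (V ω, T ω)) ⁻¹' {p : α × β | p.2 = φ p.1}) = 0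
  rw [← Measure.map_apply (hV.prodMk hT) hD, hprod, Measure.measure_prod_null hD]
  refine Eventually.of_forall fun v => ?_
  change P.map T {φ v} = 0
  rw [Measure.map_apply hT (measurableSet_singleton _), h]

variable {κ : Type*} {T : κ → Ω → ℝ≥0∞}

lemma measure_biInter_preimage_Ioi [Fintype κ] [IsProbabilityMeasure P]
    (hpos : ∀ᵐ ω ∂P, ∀ k, 0 < T k ω)
    (h : ∀ r : κ → ℝ≥0,
      P {ω | ∀ k, (r k : ℝ≥0∞) < T k ω} = ∏ k, P (T k ⁻¹' Set.Ioi (r k : ℝ≥0∞)))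
    (s : Finset κ) (r : κ → ℝ≥0) :
    P (⋂ k ∈ s, T k ⁻¹' Set.Ioi (r k : ℝ≥0∞)) = ∏ k ∈ s, P (T k ⁻¹' Set.Ioi (r k : ℝ≥0∞)) := by
  classical
  calc P (⋂ k ∈ s, T k ⁻¹' Set.Ioi (r k : ℝ≥0∞))
      = P {ω | ∀ k, ((if k ∈ s then r k else 0 : ℝ≥0) : ℝ≥0∞) < T k ω} := by
        refine measure_congr ?_
        filter_upwards [hpos] with ω hω
        change (ω ∈ ⋂ k ∈ s, T k ⁻¹' Set.Ioi (r k : ℝ≥0∞)) =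
          ∀ k, ((if k ∈ s then r k else 0 : ℝ≥0) : ℝ≥0∞) < T k ω
        simp only [Set.mem_iInter, Set.mem_preimage, Set.mem_Ioi, eq_iff_iff]
        refine forall_congr' fun k => ?_
        by_cases hk : k ∈ s
        · simp only [hk, forall_true_left, if_true]
        · simp [hk, hω k]
    _ = ∏ k, P (T k ⁻¹' Set.Ioi ((if k ∈ s then r k else 0 : ℝ≥0) : ℝ≥0∞)) := h _
    _ = ∏ k ∈ s, P (T k ⁻¹' Set.Ioi ((if k ∈ s then r k else 0 : ℝ≥0) : ℝ≥0∞)) := by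
        refine (Finset.prod_subset s.subset_univ fun k _ hk => ?_).symm
        rw [if_neg hk]
        have hk0 : T k ⁻¹' Set.Ioi ((0 : ℝ≥0) : ℝ≥0∞) =ᵐ[P] Set.univ :=
          eventuallyEq_univ.2 (by filter_upwards [hpos] with ω hω using hω k)
        rw [measure_congr hk0, measure_univ]
    _ = ∏ k ∈ s, P (T k ⁻¹' Set.Ioi (r k : ℝ≥0∞)) :=
        Finset.prod_congr rfl fun k hk => by rw [if_pos hk]

lemma iIndepFun_of_measure_biInter_preimage_Ioi (hT : ∀ k, Measurable (T k))
    (h : ∀ (s : Finset κ) (r : κ → ℝ≥0), P (⋂ k ∈ s, T k ⁻¹' Set.Ioi (r k : ℝ≥0∞)) =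
      ∏ k ∈ s, P (T k ⁻¹' Set.Ioi (r k : ℝ≥0∞))) :
    iIndepFun T P := by
  refine iIndepSets.iIndep (m := fun k => MeasurableSpace.comap (T k) inferInstance)
    (fun k => (hT k).comap_le) (fun k => {s | ∃ t ∈ Set.range Set.Ioi, T k ⁻¹' t = s})
    (fun k => isPiSystem_Ioi.comap (T k)) (fun k => ?_) ?_
  · rw [BorelSpace.measurable_eq (α := ℝ≥0∞), borel_eq_generateFrom_Ioi,
      MeasurableSpace.comap_generateFrom]
    rfl
  rw [iIndepSets_iff]
  intro s f hf
  have hf' : ∀ k, ∃ a : ℝ≥0∞, k ∈ s → T k ⁻¹' Set.Ioi a = f k := fun k => by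
    by_cases hk : k ∈ s
    · obtain ⟨_, ⟨a, rfl⟩, ha⟩ := hf k hk
      exact ⟨a, fun _ => ha⟩
    · exact ⟨0, fun hk' => absurd hk' hk⟩
  choose a ha using hf'
  by_cases htop : ∃ k ∈ s, a k = ⊤
  · obtain ⟨k, hk, hkt⟩ := htop
    have hfk : f k = ∅ := by rw [← ha k hk, hkt, Set.Ioi_top, Set.preimage_empty]
    rw [Finset.prod_eq_zero hk (by rw [hfk, measure_empty])]
    exact measure_mono_null (Set.iInter₂_subset k hk) (by rw [hfk, measure_empty])
  · push Not at htop
    have hfa : ∀ k ∈ s, f k = T k ⁻¹' Set.Ioi ((a k).toNNReal : ℝ≥0∞) := fun k hk => by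
      rw [ENNReal.coe_toNNReal (htop k hk), ha k hk]
    rw [Set.iInter₂_congr hfa, h]
    exact Finset.prod_congr rfl fun k hk => by rw [hfa k hk]

lemma measure_sum_toReal_mul_eq_zero_of_iIndepFun [Fintype κ] [IsFiniteMeasure P]
    (hind : iIndepFun T P) (hT : ∀ k, Measurable (T k)) {k : κ}
    (hatom : ∀ t : ℝ≥0∞, t ≠ ⊤ → P (T k ⁻¹' {t}) = 0) {d : κ → ℝ} (hd : d k ≠ 0) (c : ℝ) :
    P {ω | T k ω ≠ ⊤ ∧ ∑ l, (T l ω).toReal * d l = c} = 0 := by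
  classical
  let S : Finset κ := {k}ᶜ
  let rest : (S → ℝ≥0∞) → ℝ := fun v => ∑ l, (v l).toReal * d l
  let solution : (S → ℝ≥0∞) → ℝ≥0∞ := fun v => ENNReal.ofReal ((c - rest v) / d k)
  let eval : (({k} : Finset κ) → ℝ≥0∞) → ℝ≥0∞ := fun u => u ⟨k, Finset.mem_singleton_self k⟩
  have hindep : IndepFun (fun ω (l : S) => T l ω) (T k) P :=
    (hind.indepFun_finset S {k} disjoint_compl_left hT).comp measurable_id
      (measurable_pi_apply _ : Measurable eval)
  refine measure_mono_null ?_ <| measure_eq_comp_eq_zero_of_indepFun hindep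
    (measurable_pi_lambda _ fun l => hT l) (hT k) (φ := solution) (by fun_prop)
    fun v => hatom _ ENNReal.ofReal_ne_top
  rintro ω ⟨htop, hsum⟩
  have hsplit : rest (fun l => T l ω) + (T k ω).toReal * d k = c := by
    rw [← hsum, ← Finset.sum_compl_add_sum {k}, Finset.sum_singleton]
    exact congrArg (· + _) (Finset.sum_coe_sort S fun l => (T l ω).toReal * d l)
  change T k ω = ENNReal.ofReal ((c - rest fun l => T l ω) / d k)
  rw [← hsplit, add_sub_cancel_left, mul_div_cancel_right₀ _ hd, ENNReal.ofReal_toReal htop]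

end Independence

/-! ### Jump chain and holding times -/

/-- The event that the first `n + 1` states of the jump chain are `y 0, …, y n`; the values of
`y` beyond the index `n` are irrelevant. -/
def pathEvent {Ω ι : Type*} (Y : ℕ → Ω → ι) (n : ℕ) (y : ℕ → ι) : Set Ω :=
  {ω | ∀ k ≤ n, Y k ω = y k}

section PathEvent

variable {Ω ι : Type*} {Y : ℕ → Ω → ι}

lemma pathEvent_update_succ (n : ℕ) (y : ℕ → ι) (j : ι) :
    pathEvent Y (n + 1) (Function.update y (n + 1) j) = Y (n + 1) ⁻¹' {j} ∩ pathEvent Y n y := by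
  ext ω
  constructor
  · refine fun hω => ⟨by simpa using hω (n + 1) le_rfl, fun k hk => ?_⟩
    rw [hω k (by omega), Function.update_of_ne (by omega)]
  · rintro ⟨hj, hω⟩ k hk
    rcases Nat.le_succ_iff.1 hk with hk | rfl
    · rw [Function.update_of_ne (by omega), hω k hk]
    · rwa [Function.update_self]

variable [MeasurableSpace Ω] [MeasurableSpace ι] [MeasurableSingletonClass ι] {μ : Measure Ω}

lemma measurableSet_pathEvent (hY : ∀ k, Measurable (Y k)) (n : ℕ) (y : ℕ → ι) :
    MeasurableSet (pathEvent Y n y) := by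
  simp only [pathEvent, Set.ofPred_forall]
  exact .iInter fun k => .iInter fun _ => hY k (measurableSet_singleton _)

lemma sum_measure_pathEvent_update_succ [Fintype ι] (hY : ∀ k, Measurable (Y k)) (n : ℕ)
    (y : ℕ → ι) (A : Set Ω) :
    ∑ j, μ (pathEvent Y (n + 1) (Function.update y (n + 1) j) ∩ A) = μ (pathEvent Y n y ∩ A) := by
  have hmeas : ∀ j, MeasurableSet (Y (n + 1) ⁻¹' {j}) := fun j => hY _ (measurableSet_singleton j)
  simp only [pathEvent_update_succ, Set.inter_assoc, ← Measure.restrict_apply (hmeas _)]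
  rw [sum_measure_preimage_singleton _ fun j _ => hmeas j]
  simp

variable [Finite ι]

lemma measure_univ_le_of_forall_pathEvent {ν : Measure Ω} (hY : ∀ k, Measurable (Y k)) (n : ℕ)
    (h : ∀ y, μ (pathEvent Y n y) ≤ ν (pathEvent Y n y)) : μ Set.univ ≤ ν Set.univ := by
  classical
  cases nonempty_fintype ι
  let f : Ω → Fin (n + 1) → ι := fun ω k => Y k ω
  let extend : (Fin (n + 1) → ι) → ℕ → ι := fun w k => w (Fin.ofNat (n + 1) k)
  have hfibre : ∀ w, f ⁻¹' {w} = pathEvent Y n (extend w) := fun w => by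
    ext ω
    simp only [pathEvent, extend, f, Set.mem_ofPred_eq, Set.mem_preimage, Set.mem_singleton_iff,
      funext_iff, Fin.forall_iff, Nat.lt_succ_iff]
    refine forall₂_congr fun k hk => ?_
    rw [show Fin.ofNat (n + 1) k = ⟨k, by omega⟩ from Fin.ext (Nat.mod_eq_of_lt (by omega))]
  have hsum : ∀ m : Measure Ω, ∑ w, m (pathEvent Y n (extend w)) = m Set.univ := fun m => by
    simp only [← hfibre]
    rw [sum_measure_preimage_singleton _ fun w _ => ?_]
    · simp
    · rw [hfibre]
      exact measurableSet_pathEvent hY _ _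
  rw [← hsum μ, ← hsum ν]
  exact Finset.sum_le_sum fun w _ => h _

lemma measure_le_mul_of_forall_cond_pathEvent [IsFiniteMeasure μ] (hY : ∀ k, Measurable (Y k))
    (n : ℕ) {A : Set Ω} {δ : ℝ≥0∞}
    (h : ∀ y, μ (pathEvent Y n y) ≠ 0 → μ[|pathEvent Y n y] A ≤ δ) : μ A ≤ δ * μ Set.univ := by
  have hle : ∀ y, μ.restrict A (pathEvent Y n y) ≤ (δ • μ) (pathEvent Y n y) := fun y => by
    have hE := measurableSet_pathEvent hY n y
    rw [Measure.restrict_apply hE, Measure.smul_apply, smul_eq_mul]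
    rcases eq_or_ne (μ (pathEvent Y n y)) 0 with h0 | h0
    · exact (measure_mono_null Set.inter_subset_left h0).trans_le zero_le
    · rw [← cond_mul_eq_inter hE]
      exact mul_le_mul_left (h y h0) _
  simpa using measure_univ_le_of_forall_pathEvent hY n hle

lemma ae_of_forall_ae_cond_pathEvent [IsFiniteMeasure μ] (hY : ∀ k, Measurable (Y k)) (n : ℕ)
    {p : Ω → Prop} (h : ∀ y, μ (pathEvent Y n y) ≠ 0 → ∀ᵐ ω ∂μ[|pathEvent Y n y], p ω) :
    ∀ᵐ ω ∂μ, p ω := by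
  have hle := measure_le_mul_of_forall_cond_pathEvent hY n (A := {ω | ¬ p ω}) (δ := 0)
    fun y hy => (ae_iff.1 (h y hy)).le
  rw [zero_mul] at hle
  exact ae_iff.2 (nonpos_iff_eq_zero.1 hle)

end PathEvent

namespace IsJumpHolding

variable {Ω ι : Type*} [MeasurableSpace Ω] [DecidableEq ι] [MeasurableSpace ι] {μ : Measure Ω}
  {Q : Matrix ι ι ℝ} {Y : ℕ → Ω → ι} {T : ℕ → Ω → ℝ≥0∞}

lemma measurableSet_pos (h : IsJumpHolding μ Q Y T) (n : ℕ) :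
    MeasurableSet {ω | ∀ k < n, 0 < T k ω} := by
  simp only [Set.ofPred_forall]
  exact .iInter fun k => .iInter fun _ => h.measurable_hold k measurableSet_Ioi

variable [Fintype ι]

lemma measure_pathEvent_inter_lt (h : IsJumpHolding μ Q Y T) (hQ : IsGenerator Q) (n : ℕ)
    (y : ℕ → ι) (r : ℕ → ℝ≥0) :
    μ (pathEvent Y n y ∩ {ω | ∀ k < n, (r k : ℝ≥0∞) < T k ω}) =
      μ {ω | Y 0 ω = y 0} *
        (∏ k ∈ Finset.range n, ENNReal.ofReal (jumpMatrix Q (y k) (y (k + 1)))) *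
        ∏ k ∈ Finset.range n, ENNReal.ofReal (Real.exp (-(exitRate Q (y k) * r k))) := by
  rw [mul_assoc, ← Finset.prod_mul_distrib]
  simp only [← ENNReal.ofReal_mul (hQ.jumpMatrix_nonneg _ _)]
  exact h.law n y r

lemma measure_pathEvent_inter_pos (h : IsJumpHolding μ Q Y T) (hQ : IsGenerator Q) (n : ℕ)
    (y : ℕ → ι) :
    μ (pathEvent Y n y ∩ {ω | ∀ k < n, 0 < T k ω}) =
      μ {ω | Y 0 ω = y 0} *
        ∏ k ∈ Finset.range n, ENNReal.ofReal (jumpMatrix Q (y k) (y (k + 1))) := by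
  simpa using h.measure_pathEvent_inter_lt hQ n y 0

variable [MeasurableSingletonClass ι]

-- `IsJumpHolding.law` with `r = 0` only measures events on which the holding times are positive.
-- That they are positive almost surely comes from the rows of the jump matrix summing to one.
lemma measure_pathEvent_inter_pos_succ (h : IsJumpHolding μ Q Y T) (hQ : IsGenerator Q) (n : ℕ)
    (y : ℕ → ι) :
    μ (pathEvent Y n y ∩ {ω | ∀ k < n + 1, 0 < T k ω}) =
      μ (pathEvent Y n y ∩ {ω | ∀ k < n, 0 < T k ω}) := by
  rw [← sum_measure_pathEvent_update_succ h.measurable_state]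
  calc ∑ j, μ (pathEvent Y (n + 1) (Function.update y (n + 1) j) ∩ {ω | ∀ k < n + 1, 0 < T k ω})
      = ∑ j, μ {ω | Y 0 ω = y 0} *
          (∏ k ∈ Finset.range n, ENNReal.ofReal (jumpMatrix Q (y k) (y (k + 1)))) *
            ENNReal.ofReal (jumpMatrix Q (y n) j) := by
        refine Finset.sum_congr rfl fun j _ => ?_
        rw [h.measure_pathEvent_inter_pos hQ, Finset.prod_range_succ, ← mul_assoc]
        congr 2
        · refine Finset.prod_congr rfl fun k hk => ?_
          have hk' := Finset.mem_range.1 hk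
          rw [Function.update_of_ne (by omega), Function.update_of_ne (by omega)]
        · rw [Function.update_of_ne (by omega), Function.update_self]
    _ = μ (pathEvent Y n y ∩ {ω | ∀ k < n, 0 < T k ω}) := by
        rw [← Finset.mul_sum, ← ENNReal.ofReal_sum_of_nonneg fun j _ => hQ.jumpMatrix_nonneg _ _,
          hQ.sum_jumpMatrix, ENNReal.ofReal_one, mul_one, h.measure_pathEvent_inter_pos hQ]

lemma measure_forall_lt_pos (h : IsJumpHolding μ Q Y T) (hQ : IsGenerator Q) (n : ℕ) :
    μ {ω | ∀ k < n, 0 < T k ω} = μ Set.univ := by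
  induction n with
  | zero => simp
  | succ n ih =>
    refine le_antisymm (measure_mono (Set.subset_univ _)) (ih.symm.trans_le ?_)
    rw [← Measure.restrict_apply_univ, ← Measure.restrict_apply_univ {ω | ∀ k < n + 1, 0 < T k ω}]
    refine measure_univ_le_of_forall_pathEvent h.measurable_state n fun y => ?_
    have hE := measurableSet_pathEvent h.measurable_state n y
    rw [Measure.restrict_apply hE, Measure.restrict_apply hE,
      h.measure_pathEvent_inter_pos_succ hQ]

variable [IsFiniteMeasure μ]

lemma ae_pos (h : IsJumpHolding μ Q Y T) (hQ : IsGenerator Q) : ∀ᵐ ω ∂μ, ∀ k, 0 < T k ω := by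
  have hpos : ∀ n, ∀ᵐ ω ∂μ, ∀ k < n, 0 < T k ω := fun n =>
    (ae_iff_measure_eq (h.measurableSet_pos n).nullMeasurableSet).2 (h.measure_forall_lt_pos hQ n)
  filter_upwards [ae_all_iff.2 hpos] with ω hω
  exact fun k => hω (k + 1) k k.lt_succ_self

lemma measure_pathEvent (h : IsJumpHolding μ Q Y T) (hQ : IsGenerator Q) (n : ℕ) (y : ℕ → ι) :
    μ (pathEvent Y n y) = μ {ω | Y 0 ω = y 0} *
      ∏ k ∈ Finset.range n, ENNReal.ofReal (jumpMatrix Q (y k) (y (k + 1))) := by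
  rw [← h.measure_pathEvent_inter_pos hQ]
  refine measure_congr ?_
  filter_upwards [h.ae_pos hQ] with ω hω
  exact propext ⟨fun hE => ⟨hE, fun k _ => hω k⟩, fun hE => hE.1⟩

section Cond

variable {n : ℕ} {y : ℕ → ι}

lemma ae_cond_pos (h : IsJumpHolding μ Q Y T) (hQ : IsGenerator Q) (A : Set Ω) :
    ∀ᵐ ω ∂μ[|A], ∀ k, 0 < T k ω :=
  cond_absolutelyContinuous.ae_le (h.ae_pos hQ)

lemma cond_pathEvent_forall_lt (h : IsJumpHolding μ Q Y T) (hQ : IsGenerator Q)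
    (hE : μ (pathEvent Y n y) ≠ 0) (r : Fin n → ℝ≥0) :
    μ[|pathEvent Y n y] {ω | ∀ k : Fin n, (r k : ℝ≥0∞) < T k ω} =
      ∏ k : Fin n, ENNReal.ofReal (Real.exp (-(exitRate Q (y k) * r k))) := by
  let r' : ℕ → ℝ≥0 := fun k => if hk : k < n then r ⟨k, hk⟩ else 0
  have hr' : ∀ k : Fin n, r' k = r k := fun k => by simp [r']
  have hset : {ω | ∀ k : Fin n, (r k : ℝ≥0∞) < T k ω} =
      {ω | ∀ k < n, (r' k : ℝ≥0∞) < T k ω} := by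
    simp only [← hr', Fin.forall_iff]
  rw [cond_apply (measurableSet_pathEvent h.measurable_state _ _), hset,
    h.measure_pathEvent_inter_lt hQ, ← h.measure_pathEvent hQ, ← mul_assoc,
    ENNReal.inv_mul_cancel hE (measure_ne_top _ _), one_mul, Finset.prod_range]
  simp only [hr']

lemma cond_pathEvent_preimage_Ioi (h : IsJumpHolding μ Q Y T) (hQ : IsGenerator Q)
    (hE : μ (pathEvent Y n y) ≠ 0) (k : Fin n) (r : ℝ≥0) :
    μ[|pathEvent Y n y] (T k ⁻¹' Set.Ioi (r : ℝ≥0∞)) =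
      ENNReal.ofReal (Real.exp (-(exitRate Q (y k) * r))) := by
  have hjoint := h.cond_pathEvent_forall_lt hQ hE (Pi.single k r)
  rw [Finset.prod_eq_single k (fun l _ hl => by simp [hl]) (by simp), Pi.single_eq_same] at hjoint
  rw [← hjoint]
  refine measure_congr ?_
  filter_upwards [h.ae_cond_pos hQ (pathEvent Y n y)] with ω hω
  refine propext ⟨fun hk l => ?_, fun hω' => ?_⟩
  · rcases eq_or_ne l k with rfl | hl
    · rwa [Pi.single_eq_same]
    · simpa [hl] using hω l
  · change (r : ℝ≥0∞) < T k ω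
    simpa using hω' k

lemma iIndepFun_cond_pathEvent (h : IsJumpHolding μ Q Y T) (hQ : IsGenerator Q)
    (hE : μ (pathEvent Y n y) ≠ 0) : iIndepFun (fun k : Fin n => T k) (μ[|pathEvent Y n y]) := by
  have : IsProbabilityMeasure (μ[|pathEvent Y n y]) := cond_isProbabilityMeasure hE
  refine iIndepFun_of_measure_biInter_preimage_Ioi (fun k => h.measurable_hold k)
    (measure_biInter_preimage_Ioi ?_ fun r => ?_)
  · filter_upwards [h.ae_cond_pos hQ (pathEvent Y n y)] with ω hω using fun k => hω k
  · rw [h.cond_pathEvent_forall_lt hQ hE]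
    exact Finset.prod_congr rfl fun k _ => (h.cond_pathEvent_preimage_Ioi hQ hE k (r k)).symm

lemma cond_pathEvent_preimage_singleton (h : IsJumpHolding μ Q Y T) (hQ : IsGenerator Q)
    (hE : μ (pathEvent Y n y) ≠ 0) (k : Fin n) {t : ℝ≥0∞} (ht : t ≠ ⊤) :
    μ[|pathEvent Y n y] (T k ⁻¹' {t}) = 0 := by
  have hT : Measurable (T k) := h.measurable_hold k
  rcases eq_or_ne t 0 with rfl | ht0
  · refine measure_mono_null ?_ (ae_iff.1 (h.ae_cond_pos hQ (pathEvent Y n y)))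
    exact fun ω hω hpos => (hpos k).ne' hω
  have htail : ∀ r : ℝ≥0∞, r ≠ ⊤ → ((μ[|pathEvent Y n y]).map (T k)) (Set.Ioi r) =
      ENNReal.ofReal (Real.exp (-(exitRate Q (y k) * r.toReal))) := fun r hr => by
    rw [Measure.map_apply hT measurableSet_Ioi]
    lift r to ℝ≥0 using hr
    exact h.cond_pathEvent_preimage_Ioi hQ hE k r
  have : (𝓝[<] t).NeBot := nhdsLT_neBot_of_exists_lt ⟨0, pos_iff_ne_zero.2 ht0⟩
  rw [← Measure.map_apply hT (measurableSet_singleton t)]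
  refine measure_singleton_eq_zero_of_tendsto_Ioi ?_
  rw [htail t ht]
  have hlim : Tendsto (fun r : ℝ≥0∞ => ENNReal.ofReal (Real.exp (-(exitRate Q (y k) * r.toReal))))
      (𝓝[<] t) (𝓝 (ENNReal.ofReal (Real.exp (-(exitRate Q (y k) * t.toReal))))) :=
    ENNReal.tendsto_ofReal <| (((ENNReal.tendsto_toReal ht).const_mul _).neg.rexp).mono_left
      nhdsWithin_le_nhds
  refine hlim.congr' ?_
  filter_upwards [self_mem_nhdsWithin] with r hr using (htail r (ne_top_of_lt hr)).symm

end Cond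

lemma measure_forall_lt_le_one (h : IsJumpHolding μ Q Y T) (hQ : IsGenerator Q) (n : ℕ) :
    μ {ω | ∀ k < n, T k ω ≤ 1} ≤
      (1 - ENNReal.ofReal (Real.exp (-∑ i, exitRate Q i))) ^ n * μ Set.univ := by
  refine measure_le_mul_of_forall_cond_pathEvent h.measurable_state n fun y hE => ?_
  have : IsProbabilityMeasure (μ[|pathEvent Y n y]) := cond_isProbabilityMeasure hE
  have hset : {ω | ∀ k < n, T k ω ≤ 1} = ⋂ k : Fin n, T k ⁻¹' Set.Iic 1 := by
    ext ω
    simp [Fin.forall_iff]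
  rw [hset, (h.iIndepFun_cond_pathEvent hQ hE).meas_iInter fun k => ⟨_, measurableSet_Iic, rfl⟩]
  refine (Finset.prod_le_pow_card _ _ (1 - ENNReal.ofReal (Real.exp (-∑ i, exitRate Q i)))
    fun k _ => ?_).trans_eq (by simp)
  have hcompl : T k ⁻¹' Set.Iic 1 = (T k ⁻¹' Set.Ioi ((1 : ℝ≥0) : ℝ≥0∞))ᶜ := by
    rw [← Set.preimage_compl, Set.compl_Ioi, ENNReal.coe_one]
  rw [hcompl, prob_compl_eq_one_sub (h.measurable_hold k measurableSet_Ioi),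
    h.cond_pathEvent_preimage_Ioi hQ hE, NNReal.coe_one, mul_one]
  gcongr
  exact Finset.single_le_sum (fun i _ => hQ.exitRate_nonneg i) (Finset.mem_univ _)

lemma ae_exists_one_lt_sum (h : IsJumpHolding μ Q Y T) (hQ : IsGenerator Q) :
    ∀ᵐ ω ∂μ, ∃ n, 1 < ∑ k ∈ Finset.range n, T k ω := by
  have hδ : 1 - ENNReal.ofReal (Real.exp (-∑ i, exitRate Q i)) < 1 :=
    ENNReal.sub_lt_self ENNReal.one_ne_top one_ne_zero
      (ENNReal.ofReal_pos.2 (Real.exp_pos _)).ne'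
  have hlim := ENNReal.Tendsto.mul_const (b := μ Set.univ)
    (ENNReal.tendsto_pow_atTop_nhds_zero_of_lt_one hδ) (.inr (measure_ne_top μ _))
  rw [zero_mul] at hlim
  have hzero : μ {ω | ∀ k, T k ω ≤ 1} = 0 := by
    refine nonpos_iff_eq_zero.1 (ge_of_tendsto' hlim fun n => ?_)
    have hsub : {ω | ∀ k, T k ω ≤ 1} ⊆ {ω | ∀ k < n, T k ω ≤ 1} := fun ω hω k _ => hω k
    exact (measure_mono hsub).trans (h.measure_forall_lt_le_one hQ n)
  filter_upwards [measure_eq_zero_iff_ae_notMem.1 hzero] with ω hω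
  by_contra! hn
  refine hω fun k => le_trans ?_ (hn (k + 1))
  exact Finset.single_le_sum (f := fun k => T k ω) (fun _ _ => zero_le)
    (Finset.mem_range.2 k.lt_succ_self)

lemma ae_sum_toReal_mul_sub_add_ne (h : IsJumpHolding μ Q Y T) (hQ : IsGenerator Q) (b : ι → ℝ)
    (c : ℝ) :
    ∀ᵐ ω ∂μ, ∀ n, (∃ k < n, T k ω ≠ ⊤ ∧ b (Y k ω) ≠ b (Y n ω)) →
      ∑ k ∈ Finset.range n, (T k ω).toReal * (b (Y k ω) - b (Y n ω)) + b (Y n ω) ≠ c := by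
  refine ae_all_iff.2 fun n => ae_of_forall_ae_cond_pathEvent h.measurable_state n fun y hE => ?_
  have : IsProbabilityMeasure (μ[|pathEvent Y n y]) := cond_isProbabilityMeasure hE
  have hnull : ∀ k : Fin n, ∀ᵐ ω ∂μ[|pathEvent Y n y], b (y k) ≠ b (y n) →
      ¬ (T k ω ≠ ⊤ ∧ ∑ l : Fin n, (T l ω).toReal * (b (y l) - b (y n)) = c - b (y n)) := fun k => by
    by_cases hk : b (y k) = b (y n)
    · exact .of_forall fun ω hk' => absurd hk hk'
    filter_upwards [measure_eq_zero_iff_ae_notMem.1 <|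
      measure_sum_toReal_mul_eq_zero_of_iIndepFun (h.iIndepFun_cond_pathEvent hQ hE)
        (fun l => h.measurable_hold l) (d := fun l : Fin n => b (y l) - b (y n))
        (fun t ht => h.cond_pathEvent_preimage_singleton hQ hE k ht) (sub_ne_zero.2 hk)
        (c - b (y n))] with ω hω using fun _ => hω
  filter_upwards [ae_all_iff.2 hnull,
    ae_cond_mem (measurableSet_pathEvent h.measurable_state n y)] with ω hω hωE
  rintro ⟨k, hk, htop, hbk⟩ hsum
  rw [hωE k hk.le, hωE n le_rfl] at hbk
  refine hω ⟨k, hk⟩ hbk ⟨htop, ?_⟩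
  rw [← hsum, hωE n le_rfl, add_sub_cancel_right, Finset.sum_range]
  exact Finset.sum_congr rfl fun l _ => by rw [hωE l l.2.le]

end IsJumpHolding

/-! ### Weighted occupation times of a Markov chain -/

namespace IsCTMC

variable {Ω ι : Type*} [MeasurableSpace Ω] {μ : Measure Ω} [Fintype ι] [DecidableEq ι]
  [MeasurableSpace ι] [MeasurableSingletonClass ι] {Q : Matrix ι ι ℝ} {X : ℝ → Ω → ι} {b : ι → ℝ}

lemma measurable_weightedOccupation_sampled (hX : IsCTMC μ Q X) (b : ι → ℝ) {N : ℕ} (hN : N ≠ 0) :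
    Measurable (weightedOccupation b (sampled N X)) := by
  have hW : weightedOccupation b (sampled N X) =
      fun ω => (∑ n : Fin N, b (X ((n : ℝ) / N) ω)) / N :=
    funext fun ω => weightedOccupation_sampled b X ω hN
  rw [hW]
  refine .div_const (Finset.measurable_sum _ fun n _ => ?_) _
  exact (measurable_of_countable b).comp (hX.measurable _ (by positivity))

variable [IsFiniteMeasure μ]

lemma ae_exists_isStepPath (hX : IsCTMC μ Q X) (hQ : IsGenerator Q) :
    ∀ᵐ ω ∂μ, ∃ y a n, IsStepPath (X · ω) y a n := by
  obtain ⟨Y, T, hJ, hpath⟩ := hX.jump_holding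
  filter_upwards [hpath, hJ.ae_exists_one_lt_sum hQ] with ω hω ⟨n, hn⟩
  exact ⟨_, _, n, IsJumpPath.isStepPath hω hn.le⟩

lemma ae_weightedOccupation_mem (hX : IsCTMC μ Q X) (hQ : IsGenerator Q) {C : Set ℝ}
    (hC : Convex ℝ C) (hb : ∀ s, b s ∈ C) : ∀ᵐ ω ∂μ, weightedOccupation b X ω ∈ C := by
  filter_upwards [hX.ae_exists_isStepPath hQ] with ω ⟨y, a, n, hω⟩
  exact hω.weightedOccupation_mem hC hb

lemma ae_tendsto_weightedOccupation_sampled (hX : IsCTMC μ Q X) (hQ : IsGenerator Q) (b : ι → ℝ) :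
    ∀ᵐ ω ∂μ, Tendsto (fun N => weightedOccupation b (sampled N X) ω) atTop
      (𝓝 (weightedOccupation b X ω)) := by
  filter_upwards [hX.ae_exists_isStepPath hQ] with ω ⟨y, a, n, hω⟩
  exact hω.tendsto_weightedOccupation_sampled b

lemma aemeasurable_weightedOccupation (hX : IsCTMC μ Q X) (hQ : IsGenerator Q) (b : ι → ℝ) :
    AEMeasurable (weightedOccupation b X) μ := by
  refine aemeasurable_of_tendsto_metrizable_ae atTop
    (f := fun N : ℕ => weightedOccupation b (sampled (N + 1) X))
    (fun N => (hX.measurable_weightedOccupation_sampled b N.succ_ne_zero).aemeasurable) ?_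
  filter_upwards [hX.ae_tendsto_weightedOccupation_sampled hQ b] with ω hω
  exact hω.comp (tendsto_add_atTop_nat 1)

lemma ae_weightedOccupation_sampled_eq (hX : IsCTMC μ Q X) (hQ : IsGenerator Q) (b : ι → ℝ)
    (c : ℝ) :
    ∀ᵐ ω ∂μ, weightedOccupation b X ω = c →
      ∀ N, N ≠ 0 → weightedOccupation b (sampled N X) ω = c := by
  obtain ⟨Y, T, hJ, hpath⟩ := hX.jump_holding
  filter_upwards [hpath, hJ.ae_exists_one_lt_sum hQ, hJ.ae_sum_toReal_mul_sub_add_ne hQ b c]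
    with ω (hω : IsJumpPath (X · ω) (Y · ω) (T · ω)) ⟨n, hn⟩ hne hc N hN
  obtain ⟨m, -, hm, hm1⟩ :=
    exists_lt_le_lt_succ (a := fun n => ∑ k ∈ Finset.range n, T k ω) (t := 1) (by simp) hn
  have hT : ∀ k < m, T k ω ≠ ⊤ := fun k hk =>
    (((Finset.single_le_sum (f := fun k => T k ω) (fun _ _ => zero_le)
      (Finset.mem_range.2 hk)).trans hm).trans_lt ENNReal.one_lt_top).ne
  have hconst : ∀ k < m + 1, b (Y k ω) = b (Y m ω) := by
    by_contra! ⟨k, hk, hbk⟩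
    have hkm : k < m := (Nat.lt_succ_iff.1 hk).lt_of_ne fun h => hbk (by rw [h])
    exact hne m ⟨k, hkm, hT k hkm, hbk⟩ ((hω.weightedOccupation_eq_sum hm hm1 b).symm.trans hc)
  have hstep := hω.isStepPath hm1.le
  rw [← hc, hstep.weightedOccupation_eq_of_forall hconst,
    hstep.weightedOccupation_sampled_eq_of_forall hconst hN]

end IsCTMC

/-! ### The error probability given the initial state -/

/-- The conditional law given that the initial state is `i`, restricted to the event that the
final state is `j`. All the joint laws of the theorem are images of this measure. -/
noncomputable def endpointMeasure {Ω ι : Type*} [MeasurableSpace Ω] (μ : Measure Ω)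
    (X : ℝ → Ω → ι) (i j : ι) : Measure Ω :=
  (μ[|{ω | X 0 ω = i}]).restrict {ω | X 1 ω = j}

section EndpointMeasure

variable {Ω ι : Type*} [MeasurableSpace Ω] {μ : Measure Ω} {X : ℝ → Ω → ι} {i j : ι}

instance : IsFiniteMeasure (endpointMeasure μ X i j) := by
  unfold endpointMeasure
  infer_instance

lemma endpointMeasure_absolutelyContinuous : endpointMeasure μ X i j ≪ μ :=
  Measure.restrict_le_self.absolutelyContinuous.trans cond_absolutelyContinuous

lemma setIntegral_map_of_ae_mem {α β E : Type*} [MeasurableSpace α] [MeasurableSpace β]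
    [NormedAddCommGroup E] [NormedSpace ℝ E] {ν : Measure α} {W : α → β} (hW : AEMeasurable W ν)
    {s : Set β} (hs : MeasurableSet s) (hWs : ∀ᵐ ω ∂ν, W ω ∈ s) {f : β → E}
    (hf : AEStronglyMeasurable f (ν.map W)) : ∫ w in s, f w ∂(ν.map W) = ∫ ω, f (W ω) ∂ν := by
  rw [Measure.restrict_eq_self_of_ae_mem ((ae_map_iff hW hs).2 hWs), integral_map hW hf]

variable [Fintype ι] [DecidableEq ι]

instance (b : ι → ℝ) : IsFiniteMeasure (occupationLaw μ b X i j) :=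
  inferInstanceAs (IsFiniteMeasure ((endpointMeasure μ X i j).map (weightedOccupation b X)))

lemma occupationLaw_sampled (b : ι → ℝ) {N : ℕ} (hN : N ≠ 0) :
    occupationLaw μ b (sampled N X) i j =
      (endpointMeasure μ X i j).map (weightedOccupation b (sampled N X)) := by
  rw [occupationLaw, sampled_zero, sampled_one hN, endpointMeasure]

variable [MeasurableSpace ι] [MeasurableSingletonClass ι]

lemma integral_sampled_path_endpointMeasure (hX : ∀ t, 0 ≤ t → Measurable (X t)) {N : ℕ}
    (hN : N ≠ 0) (f : (Fin (N + 1) → ι) → ℝ) :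
    ∫ ω, f (fun n => X ((n : ℝ) / N) ω) ∂(endpointMeasure μ X i j) =
      ∑ s : Fin (N + 1) → ι with s (Fin.last N) = j,
        (μ[|{ω | X 0 ω = i}]).real {ω | ∀ n : Fin (N + 1), X ((n : ℝ) / N) ω = s n} * f s := by
  let path : Ω → Fin (N + 1) → ι := fun ω n => X ((n : ℝ) / N) ω
  have hpath : Measurable path := measurable_pi_lambda _ fun n => hX _ (by positivity)
  have hlast : ∀ ω, path ω (Fin.last N) = X 1 ω := fun ω => by simp [path, hN]
  have hfibre : ∀ s, path ⁻¹' {s} = {ω | ∀ n : Fin (N + 1), X ((n : ℝ) / N) ω = s n} := fun s => by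
    ext ω
    simp [path, funext_iff]
  rw [← integral_map (φ := path) hpath.aemeasurable
    (measurable_of_countable f).aestronglyMeasurable, integral_fintype .of_finite,
    Finset.sum_filter]
  refine Finset.sum_congr rfl fun s _ => ?_
  have hs := hpath (measurableSet_singleton s)
  rw [map_measureReal_apply hpath (measurableSet_singleton s), endpointMeasure,
    measureReal_restrict_apply hs, smul_eq_mul, ← hfibre]
  split_ifs with hsj
  · rw [Set.inter_eq_left.2]
    rintro ω rfl
    exact (hlast ω).symm.trans hsj
  · rw [Set.disjoint_iff_inter_eq_empty.1, measureReal_empty, zero_mul]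
    refine Set.disjoint_left.2 ?_
    rintro ω rfl hωj
    exact hsj ((hlast ω).trans hωj)

lemma jointErrorProb_le_integral_boundFun (hX : ∀ t, 0 ≤ t → Measurable (X t)) {ε : ι → ℝ}
    (hε : ∀ s, ε s ∈ Set.Icc 0 1) {M N : ℕ} (hN : N ≠ 0) {R : ℝ}
    (hM : (M : ℝ) < Real.exp (N * R) + 1) {dec : Decoder ι M N} (hdec : IsMaximumLikelihood ε dec)
    (k : Fin M) {ρ : ℝ} (hρ0 : 0 ≤ ρ) (hρ1 : ρ ≤ 1) :
    jointErrorProb μ X ε dec k i j ≤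
      ∫ ω, boundFun N ρ R (weightedOccupation (fun s => bscExponent (ε s) ρ) (sampled N X) ω)
        ∂(endpointMeasure μ X i j) := by
  simp only [weightedOccupation_sampled _ X _ hN]
  refine le_of_le_of_eq ?_ (integral_sampled_path_endpointMeasure hX hN fun s =>
    boundFun N ρ R ((∑ n : Fin N, bscExponent (ε (s n.castSucc)) ρ) / N)).symm
  exact Finset.sum_le_sum fun s _ => mul_le_mul_of_nonneg_left
    (errorGivenStates_le_boundFun hε hN hM hdec k s hρ0 hρ1) measureReal_nonneg

namespace IsCTMC

variable {Q : Matrix ι ι ℝ} {b : ι → ℝ} {I : Set ℝ} {f : ℝ → ℝ}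

lemma setIntegral_occupationLaw_sampled (hX : IsCTMC μ Q X) (hI : Convex ℝ I) (hb : ∀ s, b s ∈ I)
    {N : ℕ} (hN : N ≠ 0) (hf : Measurable f) :
    ∫ w in I, f w ∂(occupationLaw μ b (sampled N X) i j) =
      ∫ ω, f (weightedOccupation b (sampled N X) ω) ∂(endpointMeasure μ X i j) := by
  rw [occupationLaw_sampled b hN]
  exact setIntegral_map_of_ae_mem (hX.measurable_weightedOccupation_sampled b hN).aemeasurable
    hI.ordConnected.measurableSet
    (.of_forall fun ω => (isStepPath_sampled X ω hN).weightedOccupation_mem hI hb)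
    hf.aestronglyMeasurable

variable [IsFiniteMeasure μ]

lemma setIntegral_occupationLaw (hX : IsCTMC μ Q X) (hQ : IsGenerator Q) (hI : Convex ℝ I)
    (hb : ∀ s, b s ∈ I) (hf : Measurable f) :
    ∫ w in I, f w ∂(occupationLaw μ b X i j) =
      ∫ ω, f (weightedOccupation b X ω) ∂(endpointMeasure μ X i j) :=
  setIntegral_map_of_ae_mem
    ((hX.aemeasurable_weightedOccupation hQ b).mono_ac endpointMeasure_absolutelyContinuous)
    hI.ordConnected.measurableSet
    (endpointMeasure_absolutelyContinuous.ae_le (hX.ae_weightedOccupation_mem hQ hI hb))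
    hf.aestronglyMeasurable

lemma tendsto_setIntegral_boundFun_sampled (hX : IsCTMC μ Q X) (hQ : IsGenerator Q)
    (hI : Convex ℝ I) (hb : ∀ s, b s ∈ I) (ρ R : ℝ) :
    Tendsto (fun N => ∫ w in I, boundFun N ρ R w ∂(occupationLaw μ b (sampled N X) i j)) atTop
      (𝓝 (∫ w in I, (Set.Iic (ρ * R)).indicator (fun _ => (1 : ℝ)) w
        ∂(occupationLaw μ b X i j))) := by
  have hac := endpointMeasure_absolutelyContinuous (μ := μ) (X := X) (i := i) (j := j)
  rw [hX.setIntegral_occupationLaw hQ hI hb (measurable_const.indicator measurableSet_Iic)]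
  refine (tendsto_integral_boundFun (WN := fun N => weightedOccupation b (sampled N X)) ?_
    (hac.ae_le (hX.ae_tendsto_weightedOccupation_sampled hQ b)) ?_).congr' ?_
  · filter_upwards [eventually_ne_atTop 0] with N hN
    exact (hX.measurable_weightedOccupation_sampled b hN).aemeasurable
  · filter_upwards [hac.ae_le (hX.ae_weightedOccupation_sampled_eq hQ b (ρ * R))] with ω hω hW
    filter_upwards [eventually_ne_atTop 0] with N hN using hω hW N hN
  · filter_upwards [eventually_ne_atTop 0] with N hN
    exact (hX.setIntegral_occupationLaw_sampled hI hb hN (measurable_boundFun N ρ R)).symm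

end IsCTMC

lemma tendsto_setIntegral_boundFun_const (ν : Measure ℝ) [IsFiniteMeasure ν] (I : Set ℝ) (ρ R : ℝ) :
    Tendsto (fun N : ℕ => ∫ w in I, boundFun N ρ R w ∂ν) atTop
      (𝓝 (∫ w in I, (Set.Iic (ρ * R)).indicator (fun _ => (1 : ℝ)) w ∂ν)) :=
  tendsto_integral_boundFun (WN := fun _ => id) (W := id) (.of_forall fun _ => aemeasurable_id)
    (.of_forall fun _ => tendsto_const_nhds) (.of_forall fun _ hw => .of_forall fun _ => hw)

end EndpointMeasure

end RareTransition

theorem mainTheorem4_general {Ω ι : Type*} [MeasurableSpace Ω] (μ : Measure Ω) [IsFiniteMeasure μ]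
    [Fintype ι] [DecidableEq ι] [MeasurableSpace ι] [MeasurableSingletonClass ι]
    (Q : Matrix ι ι ℝ) (hQ : IsGenerator Q) (X : ℝ → Ω → ι) (hX : IsCTMC μ Q X)
    (ε : ι → ℝ) (hε : ∀ s, ε s ∈ Set.Icc 0 1) (ρ : ℝ) (hρ0 : 0 ≤ ρ) (hρ1 : ρ ≤ 1) (R : ℝ)
    (i j : ι) (_hi : μ {ω | X 0 ω = i} ≠ 0)
    (b : ι → ℝ) (hb : ∀ s, b s = bscExponent (ε s) ρ)
    (I : Set ℝ) (hI : Convex ℝ I) (hbI : ∀ s, b s ∈ I)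
    (GN : ℕ → Measure ℝ) (hGN : ∀ N, GN N = occupationLaw μ b (sampled N X) i j)
    (G : Measure ℝ) (hG : G = occupationLaw μ b X i j) :
    (∀ N : ℕ, 1 ≤ N → ∀ M : ℕ, (M : ℝ) < Real.exp (N * R) + 1 →
      ∀ dec : Decoder ι M N, IsMaximumLikelihood ε dec → ∀ k : Fin M,
        jointErrorProb μ X ε dec k i j ≤ ∫ w in I, boundFun N ρ R w ∂(GN N)) ∧
    Tendsto (fun N : ℕ => ∫ w in I, boundFun N ρ R w ∂(GN N)) atTop
      (𝓝 (∫ w in I, (Set.Iic (ρ * R)).indicator (fun _ => (1 : ℝ)) w ∂G)) ∧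
    Tendsto (fun N : ℕ => ∫ w in I, boundFun N ρ R w ∂G) atTop
      (𝓝 (∫ w in I, (Set.Iic (ρ * R)).indicator (fun _ => (1 : ℝ)) w ∂G)) ∧
    (∀ δ : ℝ, 0 < δ → ∃ N₀ : ℕ, ∀ N : ℕ, N₀ ≤ N → ∀ M : ℕ, (M : ℝ) < Real.exp (N * R) + 1 →
      ∀ dec : Decoder ι M N, IsMaximumLikelihood ε dec → ∀ k : Fin M,
        jointErrorProb μ X ε dec k i j ≤ (∫ w in I, boundFun N ρ R w ∂G) + δ) := by
  obtain rfl := funext hb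
  obtain rfl := funext hGN
  subst hG
  have hbound := fun (N : ℕ) (hN : 1 ≤ N) (M : ℕ) (hM : (M : ℝ) < Real.exp (N * R) + 1)
      (dec : Decoder ι M N) (hdec : IsMaximumLikelihood ε dec) (k : Fin M) =>
    (jointErrorProb_le_integral_boundFun (μ := μ) (i := i) (j := j) hX.measurable hε
      (Nat.one_le_iff_ne_zero.1 hN) hM hdec k hρ0 hρ1).trans_eq
      (hX.setIntegral_occupationLaw_sampled hI hbI (Nat.one_le_iff_ne_zero.1 hN)
        (measurable_boundFun N ρ R)).symm
  have hsampled := hX.tendsto_setIntegral_boundFun_sampled (i := i) (j := j) hQ hI hbI ρ R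
  have hlimit := tendsto_setIntegral_boundFun_const
    (occupationLaw μ (fun s => bscExponent (ε s) ρ) X i j) I ρ R
  refine ⟨hbound, hsampled, hlimit, fun δ hδ => ?_⟩
  have hdiff := hsampled.sub hlimit
  rw [sub_self] at hdiff
  obtain ⟨N₀, hN₀⟩ := eventually_atTop.1 (hdiff.eventually_lt_const hδ)
  refine ⟨max N₀ 1, fun N hN M hM dec hdec k => ?_⟩
  linarith [hN₀ N (le_of_max_le_left hN), hbound N (le_of_max_le_right hN) M hM dec hdec k]

theorem mainTheorem4 {Ω : Type*} [MeasurableSpace Ω] (μ : Measure Ω) [IsProbabilityMeasure μ]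
    -- the channel has `m + 1` states, with generator `Q` and crossover probabilities `ε`
    (m : ℕ) (Q : Matrix (Fin (m + 1)) (Fin (m + 1)) ℝ) (hQ : IsGenerator Q)
    (X : ℝ → Ω → Fin (m + 1)) (hX : IsCTMC μ Q X)
    (ε : Fin (m + 1) → ℝ) (hε : StrictMono ε) (hε0 : ∀ s, 0 ≤ ε s) (hε2 : ∀ s, ε s ≤ 1 / 2)
    (ρ : ℝ) (hρ0 : 0 ≤ ρ) (hρ1 : ρ ≤ 1) (R : ℝ)
    (i j : Fin (m + 1)) (hi : μ {ω | X 0 ω = i} ≠ 0)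
    (b : Fin (m + 1) → ℝ) (hb : ∀ s, b s = bscExponent (ε s) ρ)
    (I : Set ℝ) (hI : I = Set.Icc (b (Fin.last m)) (b 0))
    (GN : ℕ → Measure ℝ) (hGN : ∀ N, GN N = occupationLaw μ b (sampled N X) i j)
    (G : Measure ℝ) (hG : G = occupationLaw μ b X i j) :
    -- the upper bound at every block length
    (∀ N : ℕ, 1 ≤ N → ∀ M : ℕ, (M : ℝ) < Real.exp (N * R) + 1 →
      ∀ dec : Decoder (Fin (m + 1)) M N, IsMaximumLikelihood ε dec → ∀ k : Fin M,
        jointErrorProb μ X ε dec k i j ≤ ∫ w in I, boundFun N ρ R w ∂(GN N)) ∧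
    -- the limit of this bound
    Tendsto (fun N : ℕ => ∫ w in I, boundFun N ρ R w ∂(GN N)) atTop
      (𝓝 (∫ w in I, (Set.Iic (ρ * R)).indicator (fun _ => (1 : ℝ)) w ∂G)) ∧
    -- the approximate bound, in terms of the limiting law, has the same limit
    Tendsto (fun N : ℕ => ∫ w in I, boundFun N ρ R w ∂G) atTop
      (𝓝 (∫ w in I, (Set.Iic (ρ * R)).indicator (fun _ => (1 : ℝ)) w ∂G)) ∧
    -- so it is an upper bound up to an error that vanishes as the block length grows
    (∀ δ : ℝ, 0 < δ → ∃ N₀ : ℕ, ∀ N : ℕ, N₀ ≤ N → ∀ M : ℕ, (M : ℝ) < Real.exp (N * R) + 1 →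
      ∀ dec : Decoder (Fin (m + 1)) M N, IsMaximumLikelihood ε dec → ∀ k : Fin M,
        jointErrorProb μ X ε dec k i j ≤ (∫ w in I, boundFun N ρ R w ∂G) + δ) := by
  have hε' : ∀ s, ε s ∈ Set.Icc 0 (1 / 2) := fun s => ⟨hε0 s, hε2 s⟩
  exact mainTheorem4_general μ Q hQ X hX ε (fun s => Set.Icc_subset_Icc_right (by norm_num) (hε' s))
    ρ hρ0 hρ1 R i j hi b hb I (hI ▸ convex_Icc _ _)
    (fun s => by simpa only [hI, hb] using bscExponent_mem_Icc_last_zero hε.monotone hε' hρ0 s)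
    GN hGN G hG
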